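/- Let $\nu<\tfrac16$ and $s\ge 1$. For $f\in L^2(\mathbb R)$ (complex-valued) put $\|f\|_{H^s}^2=\int_{\mathbb R}(1+\xi^2)^s|\hat f(\xi)|^2\,d\xi$ with $\hat f(\xi)=\frac1{\sqrt{2\pi}}\int_{\mathbb R} f(x)e^{-i\xi x}\,dx$, and let $H^s=H^s(\mathbb R)$ be the space of those $f$ for which this is finite. Consider the third-order KdV--BBM initial value problem $$u_t+u_x+\tfrac32uu_x+\nu u_{xxx}-\left(\tfrac16-\nu\right)u_{xxt}=0,\qquad u(0)=u_0. \qquad (*)$$ A solution on $[0,T]$ (with $T>0$) is a function $u\in C([0,T];H^s)$ with $u(0)=u_0$ that satisfies the equation in the sense of tempered distributions in $x$ for every $t\in[0,T]$, where $uu_x=\frac12(u^2)_x$ and where $u_t$ is the derivative of $t\mapsto u(t)$ in the sense of distributions. Let $\psi(\partial_x)$ be the Fourier multiplier with symbol $\psi(\xi)=\dfrac{3\xi}{4\left[(\frac16-\nu)\xi^2+1\right]}$. There are constants $C_s>0$, depending only on $\nu$ and $s$, such that $\|\psi(\partial_x)u^2\|_{H^s}\le C_s\|u\|_{H^s}^2$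 for all $u\in H^s$. With any such $C_s$, the following holds for every $u_0\in H^s$. 1. (Existence.) Let $\tilde T=\frac{1}{4C_s\|u_0\|_{H^s}}$ ($\tilde T=\infty$ if $u_0=0$). For every finite $T$ with $0<T\le\tilde T$ there is a solution $u\in C([0,T];H^s)$ of $(*)$, and $\|u(t)\|_{H^s}\le 2\|u_0\|_{H^s}$ for all $t\in[0,T]$. In particular, the maximal existence time of the solution is at least $\tilde T$. 2. (Uniqueness.) For every $T>0$ there is at most one solution of $(*)$ in $C([0,T];H^s)$. 3. (Continuous dependence.) If $T>0$ and $u$ is a solution of $(*)$ on $[0,T]$, then for every $\varepsilon>0$ there is $\delta>0$ such that for all $v_0\in H^s$ with $\|v_0-u_0\|_{H^s}<\delta$ there is a solution $v$ on $[0,T]$ with $v(0)=v_0$, and $\|v(t)-u(t)\|_{H^s}<\varepsilon$ for all $t\in[0,T]$. 4. (Reality.) If $u_0$ is real-valued, then every solution of $(*)$ on an interval $[0,T]$ is real-valued. -/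

import Mathlib

noncomputable section

namespace KdVBBM

open MeasureTheory FourierTransform Set
open scoped ENNReal SchwartzMap

/-! ### The Sobolev space `H^s(ℝ)`, `s ≥ 0`

The symbols below are written in the angular frequency `ξ`, dual to `x` through `e^{-iξx}`.
Mathlib's Fourier transform uses `e^{-2πiηx}`, so that `ξ = 2πη`; with
`f̂(ξ) = (2π)^{-1/2} ∫ f(x) e^{-iξx} dx` one has
`∫ (1 + ξ²)^s |f̂(ξ)|² dξ = ∫ (1 + (2πη)²)^s |𝓕 f (η)|² dη`. -/

/-- `(1 + ξ²)^{s/2}`. -/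
def weight (s ξ : ℝ) : ℝ := (1 + ξ ^ 2) ^ (s / 2)

/-- The function `(1 + ξ²)^{s/2} 𝓕 f`, as a function of `η = ξ / (2π)`. -/
def weightedFourier (s : ℝ) (f : Lp ℂ 2 (volume : Measure ℝ)) (η : ℝ) : ℂ :=
  (weight s (2 * Real.pi * η) : ℂ) * (𝓕 f : Lp ℂ 2 (volume : Measure ℝ)) η

theorem weightedFourier_add (s : ℝ) (f g : Lp ℂ 2 (volume : Measure ℝ)) :
    weightedFourier s (f + g) =ᵐ[volume] weightedFourier s f + weightedFourier s g := by
  have h : (𝓕 (f + g) : Lp ℂ 2 (volume : Measure ℝ)) = 𝓕 f + 𝓕 g :=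
    FourierTransform.fourier_add f g
  filter_upwards [Lp.coeFn_add (𝓕 f : Lp ℂ 2 (volume : Measure ℝ)) (𝓕 g)] with η hη
  rw [weightedFourier, h, hη]
  exact mul_add _ _ _

theorem weightedFourier_smul (s : ℝ) (c : ℂ) (f : Lp ℂ 2 (volume : Measure ℝ)) :
    weightedFourier s (c • f) =ᵐ[volume] c • weightedFourier s f := by
  have h : (𝓕 (c • f) : Lp ℂ 2 (volume : Measure ℝ)) = c • 𝓕 f :=
    FourierTransform.fourier_smul c f
  filter_upwards [Lp.coeFn_smul c (𝓕 f : Lp ℂ 2 (volume : Measure ℝ))] with η hη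
  rw [weightedFourier, h, hη]
  exact mul_left_comm _ _ _

/-- The `L²` functions `f` with `(1 + ξ²)^{s/2} f̂ ∈ L²`. -/
def sobolevSubmodule (s : ℝ) : Submodule ℂ (Lp ℂ 2 (volume : Measure ℝ)) where
  carrier := {f | MemLp (weightedFourier s f) 2 volume}
  add_mem' {f g} hf hg := (memLp_congr_ae (weightedFourier_add s f g)).2 (hf.add hg)
  zero_mem' := by
    have h := weightedFourier_smul s 0 0
    simp only [zero_smul] at h
    exact (memLp_congr_ae h).2 MemLp.zero
  smul_mem' c f hf := (memLp_congr_ae (weightedFourier_smul s c f)).2 (hf.const_smul c)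

/-- `H^s(ℝ)` for `s ≥ 0`: complex-valued functions, with its own norm below
(not the one inherited from `L²`). -/
def Hs (s : ℝ) : Type := ↥(sobolevSubmodule s)

instance (s : ℝ) : AddCommGroup (Hs s) := inferInstanceAs (AddCommGroup ↥(sobolevSubmodule s))

instance (s : ℝ) : Module ℂ (Hs s) := inferInstanceAs (Module ℂ ↥(sobolevSubmodule s))

/-- The `L²` function underlying an element of `H^s`. -/
def Hs.toL2 {s : ℝ} : Hs s →ₗ[ℂ] Lp ℂ 2 (volume : Measure ℝ) := (sobolevSubmodule s).subtype

theorem Hs.memLp {s : ℝ} (f : Hs s) : MemLp (weightedFourier s f.toL2) 2 volume := f.2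

theorem Hs.weightedFourier_add {s : ℝ} (f g : Hs s) :
    weightedFourier s (f + g).toL2 =ᵐ[volume]
      weightedFourier s f.toL2 + weightedFourier s g.toL2 := by
  rw [map_add]
  exact KdVBBM.weightedFourier_add s f.toL2 g.toL2

theorem Hs.weightedFourier_smul {s : ℝ} (c : ℂ) (f : Hs s) :
    weightedFourier s (c • f).toL2 =ᵐ[volume] c • weightedFourier s f.toL2 := by
  rw [map_smul]
  exact KdVBBM.weightedFourier_smul s c f.toL2

/-- `f ↦ (1 + ξ²)^{s/2} f̂`, from `H^s` to `L²`. -/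
def Hs.toWeighted (s : ℝ) : Hs s →ₗ[ℂ] Lp ℂ 2 (volume : Measure ℝ) where
  toFun f := MemLp.toLp (weightedFourier s f.toL2) f.memLp
  map_add' f g :=
    (MemLp.toLp_congr _ (f.memLp.add g.memLp) (f.weightedFourier_add g)).trans
      (MemLp.toLp_add f.memLp g.memLp)
  map_smul' c f :=
    (MemLp.toLp_congr _ (f.memLp.const_smul c) (f.weightedFourier_smul c)).trans
      (MemLp.toLp_const_smul c f.memLp)

theorem weight_pos (s ξ : ℝ) : 0 < weight s ξ := by
  unfold weight
  positivity

theorem Hs.toWeighted_injective (s : ℝ) : Function.Injective (Hs.toWeighted s) := by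
  rw [injective_iff_map_eq_zero]
  intro f hf
  have h1 : weightedFourier s f.toL2 =ᵐ[volume] (0 : ℝ → ℂ) := by
    have h2 : (Hs.toWeighted s f : ℝ → ℂ) =ᵐ[volume] weightedFourier s f.toL2 :=
      MemLp.coeFn_toLp f.memLp
    rw [hf] at h2
    exact h2.symm.trans (Lp.coeFn_zero ℂ 2 volume)
  have h3 : (𝓕 f.toL2 : Lp ℂ 2 (volume : Measure ℝ)) = 0 := by
    rw [Lp.eq_zero_iff_ae_eq_zero]
    filter_upwards [h1] with η hη
    have hw : (weight s (2 * Real.pi * η) : ℂ) ≠ 0 :=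
      Complex.ofReal_ne_zero.2 (weight_pos _ _).ne'
    simpa [weightedFourier, hw] using hη
  have h4 : ‖f.toL2‖ = 0 := by
    rw [← Lp.norm_fourier_eq, h3, norm_zero]
  exact Subtype.ext (norm_eq_zero.1 h4)

/-- The norm `‖f‖_{H^s} = ‖(1 + ξ²)^{s/2} f̂‖_{L²}`. -/
instance (s : ℝ) : NormedAddCommGroup (Hs s) :=
  NormedAddCommGroup.induced (Hs s) (Lp ℂ 2 (volume : Measure ℝ)) (Hs.toWeighted s)
    (Hs.toWeighted_injective s)

instance (s : ℝ) : NormedSpace ℂ (Hs s) :=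
  NormedSpace.induced ℂ (Hs s) (Lp ℂ 2 (volume : Measure ℝ)) (Hs.toWeighted s)

/-- `f` takes real values (almost everywhere). -/
def Hs.IsReal {s : ℝ} (f : Hs s) : Prop := ∀ᵐ x : ℝ, ((f.toL2 : ℝ → ℂ) x).im = 0

/-- The tempered distribution given by `f`. -/
def Hs.toDistribution {s : ℝ} (f : Hs s) : 𝓢'(ℝ, ℂ) := Lp.toTemperedDistribution f.toL2

/-- The pointwise square `f²`, an integrable function (the product `L² × L² → L¹`). -/
def Hs.sq {s : ℝ} (f : Hs s) : Lp ℂ 1 (volume : Measure ℝ) := f.toL2 • f.toL2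

/-! ### The equation -/

/-- The distributional derivative `∂ₓ`. -/
abbrev Dx : 𝓢'(ℝ, ℂ) →L[ℂ] 𝓢'(ℝ, ℂ) := TemperedDistribution.derivCLM ℂ

/-- `u ∈ C([0,T]; H^s)` solves
`u_t + u_x + (3/2) u u_x + ν u_xxx - (1/6 - ν) u_xxt = 0`, `u(0) = u₀`.
The time derivative `u_t(t)` is the derivative of `t ↦ u(t)` in the sense of distributions
(one-sided at `0` and `T`), and for each `t ∈ [0,T]` the equation is an identity of
distributions in `x` (tested against every Schwartz function `w`), with `(3/2) u u_x = (3/4) (u²)_x`. -/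
structure IsSolution (ν : ℝ) {s : ℝ} (T : ℝ) (u₀ : Hs s) (u : ℝ → Hs s) : Prop where
  continuousOn : ContinuousOn u (Icc 0 T)
  initial : u 0 = u₀
  equation : ∃ u_t : ℝ → 𝓢'(ℝ, ℂ),
    (∀ t ∈ Icc 0 T, ∀ w : 𝓢(ℝ, ℂ),
      HasDerivWithinAt (fun τ => (u τ).toDistribution w) (u_t t w) (Icc 0 T) t) ∧
    ∀ t ∈ Icc 0 T, ∀ w : 𝓢(ℝ, ℂ),
      u_t t w + Dx (u t).toDistribution w
        + (3 / 4) * Dx (Lp.toTemperedDistribution (u t).sq) w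
        + ν * Dx (Dx (Dx (u t).toDistribution)) w
        - (1 / 6 - ν) * Dx (Dx (u_t t)) w = 0

/-- The maximal existence time of the solution with initial data `u₀`: the supremum (possibly `∞`)
of the `T > 0` such that a solution exists on `[0,T]`. -/
def maximalTime (ν : ℝ) {s : ℝ} (u₀ : Hs s) : ℝ≥0∞ :=
  ⨆ T ∈ {T : ℝ | 0 < T ∧ ∃ u, IsSolution ν T u₀ u}, ENNReal.ofReal T

/-! ### The constant `C_s` -/

/-- The symbol `ψ(ξ) = 3ξ / (4 [(1/6 - ν) ξ² + 1])`. -/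
def psi (ν ξ : ℝ) : ℝ := 3 * ξ / (4 * ((1 / 6 - ν) * ξ ^ 2 + 1))

/-- `‖ψ(∂ₓ) u²‖_{H^s}`, where `ψ(∂ₓ)` is the Fourier multiplier with symbol `ψ(ξ)`
(with the value `∞` if `ψ(∂ₓ) u²` is not in `H^s`). -/
def normPsiSq (ν : ℝ) {s : ℝ} (u : Hs s) : ℝ≥0∞ :=
  eLpNorm (fun η : ℝ => (weight s (2 * Real.pi * η) * psi ν (2 * Real.pi * η) : ℂ) *
    𝓕 (u.sq : ℝ → ℂ) η) 2 volume

/-- `C > 0` is an admissible constant in `‖ψ(∂ₓ) u²‖_{H^s} ≤ C ‖u‖²_{H^s}`, for all `u ∈ H^s`. -/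
def IsAdmissibleConstant (ν s C : ℝ) : Prop :=
  0 < C ∧ ∀ u : Hs s, normPsiSq ν u ≤ ENNReal.ofReal (C * ‖u‖ ^ 2)

end KdVBBM

end

noncomputable section

namespace KdVBBM

open MeasureTheory FourierTransform Set Filter Topology
open scoped ENNReal NNReal SchwartzMap BoundedContinuousFunction ComplexConjugate

variable {ν s : ℝ}

/-! On the Fourier side the equation reads `û_t = -i (φ û + ψ (u²)^)` with `φ = (ξ - νξ³) / (1 +
(1/6 - ν)ξ²)`. For `ν < 1/6` the denominator never vanishes, `φ` is real with at most linear growth,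
and `ψ` is bounded. The linear part may be unbounded, but it generates the unitary group `e^{-itφ}`.
With `W = (1 + ξ²)^{s/2}`, the curve `Z(t) = e^{itφ} W û(t)` solves an ordinary differential
equation `Z' = F(t, Z)` in `L²` whose field is quadratic, and `u(t) ↦ Z(t)` is an isometry of `H^s`
onto `L²` for each `t`.

The field is locally Lipschitz by `exists_bilinear_bound`, which rests on the algebra property of
`H^s`: the quotient `W(ξ) / (W(η) W(ξ - η))` is square integrable in `η`, uniformly in `ξ`. An
admissible constant `C` gives `‖F(t, z)‖ ≤ C ‖z‖²`. On the ball of radius `‖z₀‖` about `z₀` this is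
at most `4C‖z₀‖²`, so Picard–Lindelöf yields the lifespan `1 / (4C‖z₀‖)` and the bound `2‖z₀‖`.
Uniqueness is Gronwall's inequality; persistence on all of `[0,T]` follows by truncating `F`;
reality follows from uniqueness, since conjugation maps solutions to solutions.

The delicate point is that a distributional solution satisfies the `L²` equation
(`IsSolution.isODESolution`). Its pairings with test functions are differentiable, but `W û` need
not be differentiable in `L²`, and `e^{itφ}` need not be differentiable in operator norm.
Multiplication by `κ = 1 / (1 + (1/6 - ν)ξ²)` repairs both, because `φκ` and `φ²κ` are bounded. One
factor `κ` is spent on each, so the product rule differentiates `κ² Z`. Since `κ²` is injective and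
the expected derivative `F(t, Z(t))` is continuous in `L²`, `hasDerivWithinAt_of_separating` then
removes `κ²`. -/

/-! ### Bounded multipliers on `L²` -/

/-- The space `L²(ℝ; ℂ)`. -/
abbrev L2 : Type := Lp ℂ 2 (volume : Measure ℝ)

theorem memLp_boundedContinuous_mul (m : ℝ →ᵇ ℂ) (g : L2) :
    MemLp (fun x => m x * g x) 2 volume :=
  (Lp.memLp g).of_le_mul (c := ‖m‖)
    (m.continuous.aestronglyMeasurable.mul (Lp.aestronglyMeasurable g))
    (Eventually.of_forall fun x => by
      rw [norm_mul]
      exact mul_le_mul_of_nonneg_right (m.norm_coe_le_norm x) (norm_nonneg _))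

/-- Multiplication by bounded continuous functions, as operators on `L²`. -/
def mulOp : (ℝ →ᵇ ℂ) →L[ℂ] L2 →L[ℂ] L2 :=
  LinearMap.mkContinuous₂
    (LinearMap.mk₂ ℂ (fun m g => (memLp_boundedContinuous_mul m g).toLp _)
      (fun m n g => by
        rw [← MemLp.toLp_add]
        refine MemLp.toLp_congr _ _ (Eventually.of_forall fun x => ?_)
        simp [add_mul])
      (fun c m g => by
        rw [← MemLp.toLp_const_smul]
        refine MemLp.toLp_congr _ _ (Eventually.of_forall fun x => ?_)
        simp [mul_assoc])
      (fun m g h => by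
        rw [← MemLp.toLp_add]
        refine MemLp.toLp_congr _ _ ?_
        filter_upwards [Lp.coeFn_add g h] with x hx
        rw [hx]
        exact mul_add _ _ _)
      (fun c m g => by
        rw [← MemLp.toLp_const_smul]
        refine MemLp.toLp_congr _ _ ?_
        filter_upwards [Lp.coeFn_smul c g] with x hx
        rw [hx]
        exact mul_left_comm _ _ _))
    1 (fun m g => by
      rw [one_mul, LinearMap.mk₂_apply]
      refine Lp.norm_le_mul_norm_of_ae_le_mul ?_
      filter_upwards [(memLp_boundedContinuous_mul m g).coeFn_toLp] with x hx
      rw [hx, norm_mul]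
      exact mul_le_mul_of_nonneg_right (m.norm_coe_le_norm x) (norm_nonneg _))

theorem coeFn_mulOp (m : ℝ →ᵇ ℂ) (g : L2) : mulOp m g =ᵐ[volume] fun x => m x * g x :=
  (memLp_boundedContinuous_mul m g).coeFn_toLp

theorem mulOp_mul (m n : ℝ →ᵇ ℂ) (g : L2) : mulOp (m * n) g = mulOp m (mulOp n g) := by
  refine Lp.ext ?_
  filter_upwards [coeFn_mulOp (m * n) g, coeFn_mulOp m (mulOp n g), coeFn_mulOp n g]
    with x h1 h2 h3
  rw [h1, h2, h3, BoundedContinuousFunction.mul_apply, mul_assoc]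

theorem mulOp_one (g : L2) : mulOp 1 g = g := by
  refine Lp.ext ?_
  filter_upwards [coeFn_mulOp 1 g] with x h1
  simp [h1]

theorem mulOp_eq_zero {m : ℝ →ᵇ ℂ} (hm : ∀ x, m x ≠ 0) {g : L2} (h : mulOp m g = 0) : g = 0 := by
  refine Lp.ext ?_
  filter_upwards [coeFn_mulOp m g, Lp.coeFn_zero ℂ 2 (volume : Measure ℝ)] with x h1 h2
  rw [h, h2] at h1
  rw [h2]
  simpa [hm x] using h1.symm

theorem norm_mulOp_of_norm_eq_one {m : ℝ →ᵇ ℂ} (hm : ∀ x, ‖m x‖ = 1) (g : L2) :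
    ‖mulOp m g‖ = ‖g‖ := by
  refine le_antisymm (Lp.norm_le_norm_of_ae_le ?_) (Lp.norm_le_norm_of_ae_le ?_) <;>
  · filter_upwards [coeFn_mulOp m g] with x h1
    simp [h1, hm x]

theorem norm_sq_eq_integral (g : L2) : ‖g‖ ^ 2 = ∫ x, ‖g x‖ ^ 2 := by
  have h := L2.inner_def (𝕜 := ℂ) g g
  rw [inner_self_eq_norm_sq_to_K] at h
  have h2 : (fun a => inner ℂ (g a) (g a)) = fun a => (((‖g a‖ ^ 2 : ℝ)) : ℂ) := by
    ext a
    rw [inner_self_eq_norm_sq_to_K]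
    simp
  rw [h2, integral_complex_ofReal] at h
  refine Complex.ofReal_injective ?_
  rw [← h]
  simp

theorem integrable_norm_sq (g : L2) : Integrable fun x => ‖g x‖ ^ 2 :=
  (Lp.memLp g).integrable_norm_pow two_ne_zero

/-! ### The unitary group `e^{-itφ}` -/

/-- The multiplier `e^{-itφ}`. -/
def phase (φ : C(ℝ, ℝ)) (t : ℝ) : ℝ →ᵇ ℂ :=
  BoundedContinuousFunction.ofNormedAddCommGroup
    (fun x => Complex.exp (Complex.I * ((-(t * φ x) : ℝ) : ℂ))) (by fun_prop) 1
    (fun x => (Complex.norm_exp_I_mul_ofReal _).le)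

theorem phase_apply (φ : C(ℝ, ℝ)) (t x : ℝ) :
    phase φ t x = Complex.exp (Complex.I * ((-(t * φ x) : ℝ) : ℂ)) := rfl

theorem norm_phase_apply (φ : C(ℝ, ℝ)) (t x : ℝ) : ‖phase φ t x‖ = 1 :=
  Complex.norm_exp_I_mul_ofReal _

theorem phase_zero (φ : C(ℝ, ℝ)) : phase φ 0 = 1 := by
  ext x
  simp [phase_apply]

theorem phase_add (φ : C(ℝ, ℝ)) (s t : ℝ) : phase φ (s + t) = phase φ s * phase φ t := by
  ext x
  rw [BoundedContinuousFunction.mul_apply, phase_apply, phase_apply, phase_apply, ← Complex.exp_add]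
  congr 1
  push_cast
  ring

theorem mulOp_phase_neg (φ : C(ℝ, ℝ)) (t : ℝ) (g : L2) :
    mulOp (phase φ t) (mulOp (phase φ (-t)) g) = g := by
  rw [← mulOp_mul, ← phase_add, add_neg_cancel, phase_zero, mulOp_one]

theorem mulOp_neg_phase (φ : C(ℝ, ℝ)) (t : ℝ) (g : L2) :
    mulOp (phase φ (-t)) (mulOp (phase φ t) g) = g := by
  rw [← mulOp_mul, ← phase_add, neg_add_cancel, phase_zero, mulOp_one]

theorem norm_mulOp_phase (φ : C(ℝ, ℝ)) (t : ℝ) (g : L2) : ‖mulOp (phase φ t) g‖ = ‖g‖ :=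
  norm_mulOp_of_norm_eq_one (norm_phase_apply φ t) g

/-- Only strong continuity is available for unbounded `φ`. It is dominated convergence, with
dominating function `4 |g|²`. -/
theorem continuous_mulOp_phase (φ : C(ℝ, ℝ)) (g : L2) :
    Continuous fun t => mulOp (phase φ t) g := by
  rw [continuous_iff_continuousAt]
  intro t₀
  rw [ContinuousAt, tendsto_iff_norm_sub_tendsto_zero]
  have key : ∀ t, ‖mulOp (phase φ t) g - mulOp (phase φ t₀) g‖ ^ 2 =
      ∫ x, ‖phase φ t x - phase φ t₀ x‖ ^ 2 * ‖g x‖ ^ 2 := by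
    intro t
    rw [norm_sq_eq_integral]
    refine integral_congr_ae ?_
    filter_upwards [Lp.coeFn_sub (mulOp (phase φ t) g) (mulOp (phase φ t₀) g),
      coeFn_mulOp (phase φ t) g, coeFn_mulOp (phase φ t₀) g] with x h1 h2 h3
    rw [h1, Pi.sub_apply, h2, h3, ← sub_mul, norm_mul, mul_pow]
  have hc : Continuous fun t => ∫ x, ‖phase φ t x - phase φ t₀ x‖ ^ 2 * ‖g x‖ ^ 2 := by
    refine continuous_of_dominated (bound := fun x => 4 * ‖g x‖ ^ 2) ?_ ?_ ?_ ?_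
    · intro t
      exact (((phase φ t).continuous.sub (phase φ t₀).continuous).norm.pow
        2).aestronglyMeasurable.mul
        ((Lp.aestronglyMeasurable g).norm.pow 2)
    · intro t
      refine Eventually.of_forall fun x => ?_
      rw [Real.norm_of_nonneg (by positivity)]
      have : ‖phase φ t x - phase φ t₀ x‖ ≤ 2 := by
        refine (norm_sub_le _ _).trans ?_
        rw [norm_phase_apply, norm_phase_apply]
        norm_num
      have h4 : ‖phase φ t x - phase φ t₀ x‖ ^ 2 ≤ 4 := by
        nlinarith [norm_nonneg (phase φ t x - phase φ t₀ x)]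
      exact mul_le_mul_of_nonneg_right h4 (by positivity)
    · exact (integrable_norm_sq g).const_mul 4
    · refine Eventually.of_forall fun x => ?_
      simp only [phase_apply]
      fun_prop
  have h0 := (hc.tendsto t₀).sqrt
  simp only [sub_self, norm_zero, ne_eq, OfNat.ofNat_ne_zero, not_false_eq_true, zero_pow, zero_mul,
    integral_zero, Real.sqrt_zero] at h0
  refine h0.congr fun t => ?_
  rw [← key, Real.sqrt_sq (norm_nonneg _)]

/-- Taylor's formula covers `|y| ≤ 1`; for larger `y` the left side is at most `2|y| ≤ 2y²`. Having
no restriction on `y` matters, as it will be `-(τ - t) φ(x)` with `φ` unbounded. -/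
theorem norm_exp_I_mul_sub_one_sub_le (y : ℝ) :
    ‖Complex.exp (Complex.I * y) - 1 - Complex.I * y‖ ≤ 3 * y ^ 2 := by
  have hn : ‖Complex.I * (y : ℂ)‖ = |y| := by simp
  rcases le_total |y| 1 with h | h
  · refine (Complex.norm_exp_sub_one_sub_id_le (hn.trans_le h)).trans ?_
    rw [hn, sq_abs]
    nlinarith [sq_nonneg y]
  · refine (norm_sub_le _ _).trans ?_
    have h1 : ‖Complex.exp (Complex.I * y) - 1‖ ≤ |y| := by
      simpa using Real.norm_exp_I_mul_ofReal_sub_one_le (x := y)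
    rw [hn]
    nlinarith [sq_abs y]

/-- If `κ`, `φκ` and `φ²κ` are bounded, then `t ↦ κ e^{-itφ}` is differentiable in the supremum
norm. -/
theorem hasDerivAt_mul_phase {φ : C(ℝ, ℝ)} {κ κ₁ : ℝ →ᵇ ℂ} {B : ℝ}
    (h₁ : ∀ x, κ₁ x = φ x * κ x) (h₂ : ∀ x, φ x ^ 2 * ‖κ x‖ ≤ B) (t : ℝ) :
    HasDerivAt (fun τ => κ * phase φ τ) (-(Complex.I • (κ₁ * phase φ t))) t := by
  have hB : 0 ≤ B := le_trans (by positivity) (h₂ 0)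
  rw [hasDerivAt_iff_isLittleO]
  -- The Taylor remainder is at most `3 (τ - t)² φ² |κ| ≤ 3B (τ - t)²`, uniformly in `x`.
  have hO : (fun τ => κ * phase φ τ - κ * phase φ t - (τ - t) • (-(Complex.I • (κ₁ * phase φ t))))
      =O[𝓝 t] fun τ => ‖τ - t‖ ^ 2 := by
    refine Asymptotics.IsBigO.of_bound (3 * B) (Eventually.of_forall fun τ => ?_)
    rw [BoundedContinuousFunction.norm_le (by positivity)]
    intro x
    have e1 : (κ * phase φ τ - κ * phase φ t - (τ - t) • (-(Complex.I • (κ₁ * phase φ t)))) x =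
        κ x * phase φ t x * (Complex.exp (Complex.I * ((-((τ - t) * φ x) : ℝ) : ℂ)) - 1
          - Complex.I * ((-((τ - t) * φ x) : ℝ) : ℂ)) := by
      have : phase φ τ = phase φ t * phase φ (τ - t) := by
        rw [← phase_add]
        congr 1
        ring
      rw [this]
      simp only [BoundedContinuousFunction.coe_sub, BoundedContinuousFunction.coe_mul, Pi.sub_apply,
        Pi.mul_apply, BoundedContinuousFunction.coe_smul, BoundedContinuousFunction.coe_neg,
        Pi.neg_apply, h₁, phase_apply φ (τ - t) x, smul_eq_mul, Complex.real_smul]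
      push_cast
      ring
    rw [e1, norm_mul, norm_mul, norm_phase_apply, mul_one]
    refine (mul_le_mul_of_nonneg_left (norm_exp_I_mul_sub_one_sub_le _) (norm_nonneg _)).trans ?_
    rw [norm_pow, norm_norm, Real.norm_eq_abs, sq_abs]
    have := mul_le_mul_of_nonneg_left (h₂ x) (by positivity : 0 ≤ 3 * (τ - t) ^ 2)
    linarith
  refine hO.trans_isLittleO ?_
  have := Asymptotics.isLittleO_norm_norm.2 (Asymptotics.isLittleO_pow_sub_sub t (one_lt_two))
  simpa using this.norm_right

/-! ### Fourier transforms of products. -/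

theorem schwartz_fourier_mul (f g : 𝓢(ℝ, ℂ)) (ξ : ℝ) :
    𝓕 (fun x => f x * g x) ξ = ∫ η, 𝓕 f η * 𝓕 g (ξ - η) := by
  set B := ContinuousLinearMap.mul ℂ ℂ
  have h1 : 𝓕⁻ (SchwartzMap.convolution B (𝓕 f) (𝓕 g)) = SchwartzMap.pairing B f g := by
    ext x
    rw [SchwartzMap.fourierInv_coe, Real.fourierInv_eq_fourier_neg, ← SchwartzMap.fourier_coe,
      SchwartzMap.fourier_convolution, SchwartzMap.pairing_apply_apply,
      SchwartzMap.pairing_apply_apply]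
    have h : ∀ k : 𝓢(ℝ, ℂ), 𝓕 (𝓕 k) (-x) = k x := fun k => by
      rw [SchwartzMap.fourier_coe, ← Real.fourierInv_eq_fourier_neg, ← SchwartzMap.fourierInv_coe,
        FourierTransform.fourierInv_fourier_eq]
    rw [h, h]
  have h2 : 𝓕 (SchwartzMap.pairing B f g) = SchwartzMap.convolution B (𝓕 f) (𝓕 g) := by
    rw [← h1, FourierTransform.fourier_fourierInv_eq]
  have h3 : (fun x => f x * g x) = SchwartzMap.pairing B f g := by
    ext x
    rw [SchwartzMap.pairing_apply_apply]
    rfl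
  rw [h3, ← SchwartzMap.fourier_coe, h2, SchwartzMap.convolution_apply]
  rfl

theorem fourier_coeFn_sub (h k : Lp ℂ 1 (volume : Measure ℝ)) (ξ : ℝ) :
    𝓕 ((h - k : Lp ℂ 1 (volume : Measure ℝ)) : ℝ → ℂ) ξ =
      𝓕 (h : ℝ → ℂ) ξ - 𝓕 (k : ℝ → ℂ) ξ := by
  simp only [Real.fourier_real_eq]
  rw [← integral_sub]
  · refine integral_congr_ae ?_
    filter_upwards [Lp.coeFn_sub h k] with x hx
    rw [hx, Pi.sub_apply, smul_sub]
  · simpa [mul_comm] using (Real.fourierIntegral_convergent_iff ξ).2 (L1.integrable_coeFn h)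
  · simpa [mul_comm] using (Real.fourierIntegral_convergent_iff ξ).2 (L1.integrable_coeFn k)

theorem continuous_fourier_apply (ξ : ℝ) :
    Continuous fun h : Lp ℂ 1 (volume : Measure ℝ) => 𝓕 (h : ℝ → ℂ) ξ := by
  refine (LipschitzWith.of_dist_le_mul (K := 1) fun h k => ?_).continuous
  rw [dist_eq_norm, dist_eq_norm, ← fourier_coeFn_sub, NNReal.coe_one, one_mul,
    L1.norm_eq_integral_norm]
  exact VectorFourier.norm_fourierIntegral_le_integral_norm _ _ _ _ _

theorem measurePreserving_const_sub (ξ : ℝ) :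
    MeasurePreserving (fun η : ℝ => ξ - η) volume volume :=
  Measure.measurePreserving_sub_left volume ξ

/-- The Fourier transform of a product of two `L²` functions is the convolution of their Fourier
transforms. -/
theorem fourier_smul_eq_integral (f g : L2) (ξ : ℝ) :
    𝓕 ((f • g : Lp ℂ 1 (volume : Measure ℝ)) : ℝ → ℂ) ξ =
      ∫ η, (𝓕 f : L2) η * (𝓕 g : L2) (ξ - η) := by
  set B := ContinuousLinearMap.mul ℂ ℂ
  set R : L2 →L[ℂ] L2 :=
    (Lp.compMeasurePreservingₗᵢ ℂ _ (measurePreserving_const_sub ξ)).toContinuousLinearMap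
  have hR : ∀ k : L2, (R k : ℝ → ℂ) =ᵐ[volume] fun η => k (ξ - η) := fun k =>
    Lp.coeFn_compMeasurePreserving k (measurePreserving_const_sub ξ)
  have hr : ∀ f g : L2, ∫ η, (𝓕 f : L2) η * (𝓕 g : L2) (ξ - η) =
      B.lpPairing volume 2 2 (𝓕 f : L2) (R (𝓕 g)) := fun f g => by
    rw [ContinuousLinearMap.lpPairing_eq_integral]
    refine integral_congr_ae ?_
    filter_upwards [hR (𝓕 g)] with η h
    rw [h]
    rfl
  have hF : Continuous fun f : L2 => (𝓕 f : L2) := FourierTransform.continuous_fourier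
  have hs : ∀ f g : L2, (f • g : Lp ℂ 1 (volume : Measure ℝ)) = B.holderL volume 2 2 1 f g := by
    intro f g
    refine Lp.ext ?_
    filter_upwards [Lp.coeFn_lpSMul (r := 1) f g, B.coeFn_holder (r := 1) f g] with x h1 h2
    rw [h1]
    exact h2.symm
  simp only [hr, hs]
  have hd := SchwartzMap.denseRange_toLpCLM (F := ℂ) (E := ℝ) (p := 2) (μ := volume)
    ENNReal.ofNat_ne_top
  set P : L2 → L2 → Prop := fun f g =>
    𝓕 ((B.holderL volume 2 2 1 f g : Lp ℂ 1 (volume : Measure ℝ)) : ℝ → ℂ) ξ =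
      B.lpPairing volume 2 2 (𝓕 f : L2) (R (𝓕 g))
  -- For fixed `ξ` both sides are continuous in `f` and in `g` separately, so density of Schwartz
  -- functions is applied to one variable at a time.
  refine hd.induction_on (p := fun f => P f g) f ?_ fun f₀ => ?_
  · refine isClosed_eq ?_ ?_
    · exact (continuous_fourier_apply ξ).comp ((B.holderL volume 2 2 1).flip g).continuous
    · exact ((B.lpPairing volume 2 2).flip (R (𝓕 g))).continuous.comp hF
  refine hd.induction_on (p := fun g => P (SchwartzMap.toLpCLM ℝ ℂ 2 volume f₀) g) g ?_ fun g₀ => ?_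
  · refine isClosed_eq ?_ ?_
    · exact (continuous_fourier_apply ξ).comp ((B.holderL volume 2 2 1) _).continuous
    · exact ((B.lpPairing volume 2 2) _).continuous.comp (R.continuous.comp hF)
  simp only [P]
  rw [← hr, ← hs]
  simp only [SchwartzMap.toLpCLM_apply]
  have h1 : ((f₀.toLp 2 • g₀.toLp 2 : Lp ℂ 1 (volume : Measure ℝ)) : ℝ → ℂ) =ᵐ[volume]
      fun x => f₀ x * g₀ x := by
    filter_upwards [Lp.coeFn_lpSMul (r := 1) (f₀.toLp 2 : L2) (g₀.toLp 2 : L2),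
      f₀.coeFn_toLp 2 volume, g₀.coeFn_toLp 2 volume] with x h1 h2 h3
    rw [h1, Pi.smul_apply', h2, h3, smul_eq_mul]
  have h2 : 𝓕 ((f₀.toLp 2 • g₀.toLp 2 : Lp ℂ 1 (volume : Measure ℝ)) : ℝ → ℂ) ξ =
      𝓕 (fun x => f₀ x * g₀ x) ξ := by
    simp only [Real.fourier_real_eq]
    refine integral_congr_ae ?_
    filter_upwards [h1] with x hx
    rw [hx]
  rw [h2, schwartz_fourier_mul, SchwartzMap.toLp_fourier_eq, SchwartzMap.toLp_fourier_eq]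
  refine integral_congr_ae ?_
  filter_upwards [(𝓕 f₀).coeFn_toLp 2 volume,
    (measurePreserving_const_sub ξ).quasiMeasurePreserving.ae_eq_comp
      ((𝓕 g₀).coeFn_toLp 2 volume)] with η h3 h4
  rw [h3]
  simp only [Function.comp_apply] at h4
  rw [h4]

/-! ### The bilinear estimate in `H^s`. -/

theorem lintegral_mul_sq_le {f g : ℝ → ℝ≥0∞} (hf : AEMeasurable f) (hg : AEMeasurable g) :
    (∫⁻ x, f x * g x) ^ 2 ≤ (∫⁻ x, f x ^ 2) * ∫⁻ x, g x ^ 2 := by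
  have h := ENNReal.lintegral_mul_le_Lp_mul_Lq volume Real.HolderConjugate.two_two hf hg
  simp only [Pi.mul_apply, ENNReal.rpow_ofNat] at h
  refine (pow_le_pow_left' h 2).trans ?_
  rw [mul_pow, ← ENNReal.rpow_natCast, ← ENNReal.rpow_natCast, ← ENNReal.rpow_mul,
    ← ENNReal.rpow_mul]
  norm_num

theorem eLpNorm_two_sq (f : ℝ → ℂ) : eLpNorm f 2 volume ^ 2 = ∫⁻ x, ‖f x‖ₑ ^ 2 := by
  have := eLpNorm_nnreal_pow_eq_lintegral (f := f) (p := 2) (μ := volume) two_ne_zero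
  simpa using this

theorem continuous_fourier_coeFn (h : Lp ℂ 1 (volume : Measure ℝ)) :
    Continuous (𝓕 (h : ℝ → ℂ)) :=
  VectorFourier.fourierIntegral_continuous Real.continuous_fourierChar
    (by exact continuous_inner) (L1.integrable_coeFn h)

theorem weight_sq (s ξ : ℝ) : weight s ξ ^ 2 = (1 + ξ ^ 2) ^ s := by
  rw [weight, ← Real.rpow_natCast, ← Real.rpow_mul (by positivity)]
  congr 1
  push_cast
  ring

theorem continuous_weight (s : ℝ) : Continuous (weight s) := by
  unfold weight
  exact Continuous.rpow_const (by fun_prop) fun x => Or.inl (by positivity)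

/-- The reason is `|x + y| ≤ 2 max(|x|, |y|)`: a frequency of the product is controlled by the
larger of the two input frequencies. -/
theorem weight_sq_le_add {s : ℝ} (hs : 0 ≤ s) (x y : ℝ) :
    weight s (x + y) ^ 2 ≤ 4 ^ s * (weight s x ^ 2 + weight s y ^ 2) := by
  simp only [weight_sq]
  have hx : 0 ≤ (1 + x ^ 2) ^ s := by positivity
  have hy : 0 ≤ (1 + y ^ 2) ^ s := by positivity
  have key : ∀ z : ℝ, 1 + (x + y) ^ 2 ≤ 4 * (1 + z ^ 2) →
      (1 + (x + y) ^ 2) ^ s ≤ 4 ^ s * (1 + z ^ 2) ^ s := fun z hz => by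
    rw [← Real.mul_rpow (by norm_num) (by positivity)]
    exact Real.rpow_le_rpow (by positivity) hz hs
  have h4 : (0 : ℝ) ≤ 4 ^ s := by positivity
  rcases le_total (x ^ 2) (y ^ 2) with h | h
  · refine (key y ?_).trans (mul_le_mul_of_nonneg_left (by linarith) h4)
    nlinarith [sq_nonneg (x - y)]
  · refine (key x ?_).trans (mul_le_mul_of_nonneg_left (by linarith) h4)
    nlinarith [sq_nonneg (x - y)]

theorem one_add_sq_le_weight_sq {s : ℝ} (hs : 1 ≤ s) (ξ : ℝ) : 1 + ξ ^ 2 ≤ weight s ξ ^ 2 := by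
  rw [weight_sq]
  exact Real.self_le_rpow_of_one_le (by nlinarith [sq_nonneg ξ]) hs

theorem exists_abs_psi_le {ν : ℝ} (hν : ν < 1 / 6) : ∃ K, 0 < K ∧ ∀ ξ, |psi ν ξ| ≤ K := by
  -- The denominator satisfies `(1/6 - ν)ξ² + 1 ≥ m(1 + ξ²) ≥ 2m|ξ|`, whence the bound `3 / (8m)`.
  set m := min (1 / 6 - ν) 1
  have hm : 0 < m := lt_min (by linarith) one_pos
  refine ⟨3 / (8 * m), by positivity, fun ξ => ?_⟩
  have ha : 0 < 1 / 6 - ν := by linarith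
  have h1 : m * (1 + ξ ^ 2) ≤ (1 / 6 - ν) * ξ ^ 2 + 1 := by
    nlinarith [min_le_left (1 / 6 - ν) 1, min_le_right (1 / 6 - ν) 1, sq_nonneg ξ]
  have h2 : 2 * |ξ| ≤ 1 + ξ ^ 2 := by nlinarith [sq_nonneg (|ξ| - 1), sq_abs ξ]
  have hd : 0 < (1 / 6 - ν) * ξ ^ 2 + 1 := by positivity
  rw [psi, abs_div, abs_of_pos (by positivity : 0 < 4 * ((1 / 6 - ν) * ξ ^ 2 + 1)), abs_mul,
    div_le_div_iff₀ (by positivity) (by positivity)]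
  have : |(3 : ℝ)| = 3 := by norm_num
  rw [this]
  nlinarith [mul_le_mul_of_nonneg_left h2 hm.le]

theorem continuous_psi {ν : ℝ} (hν : ν < 1 / 6) : Continuous (psi ν) := by
  unfold psi
  refine Continuous.div (by fun_prop) (by fun_prop) fun ξ => ?_
  have : 0 < 1 / 6 - ν := by linarith
  positivity

theorem lintegral_inv_weight_sq_lt_top {s : ℝ} (hs : 1 ≤ s) :
    ∫⁻ η : ℝ, ENNReal.ofReal ((weight s (2 * Real.pi * η) ^ 2)⁻¹) < ∞ := by
  have h : Integrable fun η : ℝ => (1 + (2 * Real.pi * η) ^ 2)⁻¹ :=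
    integrable_inv_one_add_sq.comp_mul_left' (by positivity)
  refine lt_of_le_of_lt (lintegral_mono fun η => ?_) h.lintegral_lt_top
  exact ENNReal.ofReal_le_ofReal
    (inv_anti₀ (by positivity) (one_add_sq_le_weight_sq hs _))

theorem Hs.norm_eq {s : ℝ} (f : Hs s) : ‖f‖ = ‖Hs.toWeighted s f‖ := rfl

theorem Hs.enorm_eq {s : ℝ} (f : Hs s) :
    ENNReal.ofReal ‖f‖ = eLpNorm (weightedFourier s f.toL2) 2 volume := by
  rw [Hs.norm_eq, Hs.toWeighted]
  exact (congrArg ENNReal.ofReal (Lp.norm_toLp _ f.memLp)).trans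
    (ENNReal.ofReal_toReal f.memLp.2.ne)

/-- Tonelli and translation invariance; it is applied to the squared moduli left by Cauchy–Schwarz.
-/
theorem lintegral_convolution_eq {a b : ℝ → ℝ≥0∞} (ha : AEMeasurable a) (hb : AEMeasurable b) :
    ∫⁻ ξ, ∫⁻ η, a η * b (ξ - η) = (∫⁻ η, a η) * ∫⁻ η, b η := by
  rw [lintegral_lintegral_swap]
  · rw [← lintegral_mul_const'' _ ha]
    refine lintegral_congr fun η => ?_
    rw [lintegral_const_mul'', lintegral_sub_right_eq_self]
    exact hb.comp_quasiMeasurePreserving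
      (measurePreserving_sub_right volume η).quasiMeasurePreserving
  · exact (ha.comp_quasiMeasurePreserving Measure.quasiMeasurePreserving_snd).mul
      (hb.comp_quasiMeasurePreserving (quasiMeasurePreserving_sub_of_right_invariant volume volume))

/-- Dividing `weight_sq_le_add` by `W(η)² W(ξ - η)²` leaves `W(η)⁻² + W(ξ - η)⁻²`. Both terms have
the same integral, so the bound does not depend on `ξ`; it is finite because `W⁻² ≤ (1 + ξ²)⁻¹` for
`s ≥ 1`. -/
theorem lintegral_weight_quotient_sq_le {s : ℝ} (hs : 1 ≤ s) (ξ : ℝ) :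
    ∫⁻ η : ℝ, ENNReal.ofReal (weight s (2 * Real.pi * ξ) /
        (weight s (2 * Real.pi * η) * weight s (2 * Real.pi * (ξ - η)))) ^ 2 ≤
      ENNReal.ofReal (4 ^ s) *
        (2 * ∫⁻ η : ℝ, ENNReal.ofReal ((weight s (2 * Real.pi * η) ^ 2)⁻¹)) := by
  set I := fun η : ℝ => ENNReal.ofReal ((weight s (2 * Real.pi * η) ^ 2)⁻¹)
  have hI : Measurable I := by
    have := (continuous_weight s).measurable
    fun_prop
  have hp : ∀ η : ℝ, 0 < weight s (2 * Real.pi * η) := fun η => weight_pos _ _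
  calc _ ≤ ∫⁻ η, ENNReal.ofReal (4 ^ s) * (I η + I (ξ - η)) := by
        refine lintegral_mono fun η => ?_
        simp only [I]
        rw [← ENNReal.ofReal_pow (div_nonneg (hp _).le (mul_pos (hp _) (hp _)).le),
          ← ENNReal.ofReal_add (by positivity) (by positivity),
          ← ENNReal.ofReal_mul (by positivity)]
        refine ENNReal.ofReal_le_ofReal ?_
        have h := weight_sq_le_add (by linarith : 0 ≤ s) (2 * Real.pi * η) (2 * Real.pi * (ξ - η))
        rw [show 2 * Real.pi * η + 2 * Real.pi * (ξ - η) = 2 * Real.pi * ξ by ring] at h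
        have h1 := hp η
        have h2 := hp (ξ - η)
        rw [div_pow, div_le_iff₀ (by positivity)]
        refine h.trans (le_of_eq ?_)
        field_simp
        ring
    _ = _ := by
        rw [lintegral_const_mul _ (by fun_prop), lintegral_add_left hI,
          lintegral_sub_left_eq_self I ξ, two_mul]

/-- The bilinear estimate behind `‖ψ(∂ₓ)(fg)‖_{H^s} ≤ C ‖f‖_{H^s} ‖g‖_{H^s}`. -/
theorem exists_bilinear_bound {ν s : ℝ} (hν : ν < 1 / 6) (hs : 1 ≤ s) :
    ∃ C : ℝ, 0 < C ∧ ∀ f g : Hs s,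
      eLpNorm (fun η : ℝ => (weight s (2 * Real.pi * η) * psi ν (2 * Real.pi * η) : ℂ) *
        𝓕 ((f.toL2 • g.toL2 : Lp ℂ 1 (volume : Measure ℝ)) : ℝ → ℂ) η) 2 volume ≤
        ENNReal.ofReal (C * ‖f‖ * ‖g‖) := by
  obtain ⟨K, hK, hψ⟩ := exists_abs_psi_le hν
  set I := ∫⁻ η : ℝ, ENNReal.ofReal ((weight s (2 * Real.pi * η) ^ 2)⁻¹)
  have hI : I < ∞ := lintegral_inv_weight_sq_lt_top hs
  set D : ℝ≥0∞ := ENNReal.ofReal K ^ 2 * (ENNReal.ofReal (4 ^ s) * (2 * I))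
  have hD : D ≠ ∞ := by
    refine ENNReal.mul_ne_top (by simp) (ENNReal.mul_ne_top (by simp) ?_)
    exact ENNReal.mul_ne_top (by simp) hI.ne
  -- The constant must dominate the square root of `D`; adding `1` makes it positive at no cost.
  refine ⟨Real.sqrt D.toReal + 1, by positivity, fun f g => ?_⟩
  set a := weightedFourier s f.toL2
  set b := weightedFourier s g.toL2
  have ha : AEMeasurable (fun η => ‖a η‖ₑ) := f.memLp.1.enorm
  have hb : AEMeasurable (fun η => ‖b η‖ₑ) := g.memLp.1.enorm
  set W := fun η : ℝ => weight s (2 * Real.pi * η)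
  have hW : ∀ η, 0 < W η := fun η => weight_pos _ _
  have hWm : Measurable W := by
    have := (continuous_weight s).measurable
    fun_prop
  -- Write the transform of the product as a convolution, split off the quotient of weights and
  -- apply Cauchy–Schwarz in `η`. Of `ψ` only boundedness is used.
  have pt : ∀ ξ : ℝ, ‖(weight s (2 * Real.pi * ξ) * psi ν (2 * Real.pi * ξ) : ℂ) *
        𝓕 ((f.toL2 • g.toL2 : Lp ℂ 1 (volume : Measure ℝ)) : ℝ → ℂ) ξ‖ₑ ^ 2 ≤
      D * ∫⁻ η, ‖a η‖ₑ ^ 2 * ‖b (ξ - η)‖ₑ ^ 2 := by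
    intro ξ
    have hbξ : AEMeasurable (fun η => ‖b (ξ - η)‖ₑ) :=
      hb.comp_quasiMeasurePreserving (measurePreserving_const_sub ξ).quasiMeasurePreserving
    have h1 : ENNReal.ofReal (W ξ) *
        ‖𝓕 ((f.toL2 • g.toL2 : Lp ℂ 1 (volume : Measure ℝ)) : ℝ → ℂ) ξ‖ₑ ≤
        ∫⁻ η, (‖a η‖ₑ * ‖b (ξ - η)‖ₑ) * ENNReal.ofReal (W ξ / (W η * W (ξ - η))) := by
      rw [fourier_smul_eq_integral]
      refine (mul_le_mul_right (enorm_integral_le_lintegral_enorm _) _).trans ?_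
      rw [← lintegral_const_mul' _ _ ENNReal.ofReal_ne_top]
      refine lintegral_mono fun η => le_of_eq ?_
      simp only [a, b, weightedFourier, enorm_mul]
      have e : ∀ x : ℝ, ‖(weight s (2 * Real.pi * x) : ℂ)‖ₑ = ENNReal.ofReal (W x) := fun x => by
        rw [← ofReal_norm, Complex.norm_real, Real.norm_of_nonneg (hW x).le]
      rw [e, e]
      have e2 : ENNReal.ofReal (W ξ) = ENNReal.ofReal (W η) * ENNReal.ofReal (W (ξ - η)) *
          ENNReal.ofReal (W ξ / (W η * W (ξ - η))) := by
        rw [← ENNReal.ofReal_mul (hW _).le, ← ENNReal.ofReal_mul (mul_pos (hW _) (hW _)).le,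
          mul_div_cancel₀ _ (mul_pos (hW _) (hW _)).ne']
      rw [e2]
      ring
    have h2 := lintegral_mul_sq_le (ha.mul hbξ)
      (g := fun η => ENNReal.ofReal (W ξ / (W η * W (ξ - η)))) (by fun_prop)
    have h3 : ‖(weight s (2 * Real.pi * ξ) * psi ν (2 * Real.pi * ξ) : ℂ)‖ₑ ≤
        ENNReal.ofReal K * ENNReal.ofReal (W ξ) := by
      rw [← ofReal_norm, ← ENNReal.ofReal_mul hK.le, norm_mul, Complex.norm_real,
        Complex.norm_real, Real.norm_of_nonneg (hW ξ).le, mul_comm]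
      exact ENNReal.ofReal_le_ofReal (mul_le_mul_of_nonneg_right (hψ _) (hW ξ).le)
    rw [enorm_mul]
    calc _ ≤ (ENNReal.ofReal K * (ENNReal.ofReal (W ξ) *
          ‖𝓕 ((f.toL2 • g.toL2 : Lp ℂ 1 (volume : Measure ℝ)) : ℝ → ℂ) ξ‖ₑ)) ^ 2 := by
          rw [← mul_assoc]
          gcongr
      _ ≤ (ENNReal.ofReal K) ^ 2 * ((∫⁻ η, ‖a η‖ₑ ^ 2 * ‖b (ξ - η)‖ₑ ^ 2) *
          (ENNReal.ofReal (4 ^ s) * (2 * I))) := by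
          rw [mul_pow]
          gcongr
          refine (pow_le_pow_left' h1 2).trans (h2.trans ?_)
          simp only [Pi.mul_apply, mul_pow]
          gcongr
          exact lintegral_weight_quotient_sq_le hs ξ
      _ = _ := by ring
  clear_value D
  have hD2 : D ≤ ENNReal.ofReal (Real.sqrt D.toReal + 1) ^ 2 := by
    rw [← ENNReal.ofReal_pow (by positivity)]
    refine (ENNReal.le_ofReal_iff_toReal_le hD (by positivity)).2 ?_
    nlinarith [Real.sq_sqrt (ENNReal.toReal_nonneg (a := D)), Real.sqrt_nonneg D.toReal]
  have hsq : eLpNorm (fun η : ℝ => (weight s (2 * Real.pi * η) * psi ν (2 * Real.pi * η) : ℂ) *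
        𝓕 ((f.toL2 • g.toL2 : Lp ℂ 1 (volume : Measure ℝ)) : ℝ → ℂ) η) 2 volume ^ 2 ≤
      ENNReal.ofReal ((Real.sqrt D.toReal + 1) * ‖f‖ * ‖g‖) ^ 2 := by
    rw [eLpNorm_two_sq]
    refine (lintegral_mono pt).trans ?_
    rw [lintegral_const_mul' _ _ hD, lintegral_convolution_eq (ha.pow_const 2) (hb.pow_const 2),
      ← eLpNorm_two_sq, ← eLpNorm_two_sq, ← Hs.enorm_eq, ← Hs.enorm_eq,
      ENNReal.ofReal_mul (by positivity), ENNReal.ofReal_mul (by positivity), mul_pow, mul_pow,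
      mul_assoc (ENNReal.ofReal _ ^ 2)]
    exact mul_le_mul_left hD2 _
  exact (ENNReal.pow_le_pow_left_iff two_ne_zero).1 hsq

/-! ### `H^s` is isometric to `L²` -/

theorem one_le_weight {s : ℝ} (hs : 1 ≤ s) (ξ : ℝ) : 1 ≤ weight s ξ := by
  have h := one_add_sq_le_weight_sq hs ξ
  nlinarith [weight_pos s ξ, sq_nonneg ξ]

/-- The multiplier `(1 + ξ²)^{-s/2}`. -/
def invWeight {s : ℝ} (hs : 1 ≤ s) : ℝ →ᵇ ℂ :=
  BoundedContinuousFunction.ofNormedAddCommGroup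
    (fun η => (((weight s (2 * Real.pi * η))⁻¹ : ℝ) : ℂ))
    (Complex.continuous_ofReal.comp (Continuous.inv₀
      ((continuous_weight s).comp (by fun_prop)) fun η => (weight_pos _ _).ne')) 1
    (fun η => by
      rw [Complex.norm_real, Real.norm_of_nonneg (inv_nonneg.2 (weight_pos _ _).le)]
      exact inv_le_one_of_one_le₀ (one_le_weight hs _))

theorem invWeight_apply {s : ℝ} (hs : 1 ≤ s) (η : ℝ) :
    invWeight hs η = (((weight s (2 * Real.pi * η))⁻¹ : ℝ) : ℂ) := rfl

theorem Hs.coeFn_toWeighted {s : ℝ} (f : Hs s) :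
    (Hs.toWeighted s f : ℝ → ℂ) =ᵐ[volume] weightedFourier s f.toL2 :=
  MemLp.coeFn_toLp f.memLp

theorem Hs.toWeighted_surjective {s : ℝ} (hs : 1 ≤ s) :
    Function.Surjective (Hs.toWeighted s) := by
  intro z
  set f : L2 := 𝓕⁻ (mulOp (invWeight hs) z)
  have h : weightedFourier s f =ᵐ[volume] z := by
    have hf : (𝓕 f : L2) = mulOp (invWeight hs) z := FourierTransform.fourier_fourierInv_eq _
    filter_upwards [coeFn_mulOp (invWeight hs) z] with η hη
    rw [weightedFourier, hf, hη, invWeight_apply, ← mul_assoc, ← Complex.ofReal_mul,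
      mul_inv_cancel₀ (weight_pos _ _).ne', Complex.ofReal_one, one_mul]
  refine ⟨⟨f, (memLp_congr_ae h).2 (Lp.memLp z)⟩, Lp.ext ?_⟩
  exact (Hs.coeFn_toWeighted _).trans h

/-- The isometry `f ↦ (1 + ξ²)^{s/2} f̂` of `H^s` onto `L²`. -/
def Hs.equivL2 {s : ℝ} (hs : 1 ≤ s) : Hs s ≃ₗᵢ[ℂ] L2 where
  toLinearEquiv := LinearEquiv.ofBijective (Hs.toWeighted s)
    ⟨Hs.toWeighted_injective s, Hs.toWeighted_surjective hs⟩
  norm_map' _ := rfl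

theorem Hs.equivL2_apply {s : ℝ} (hs : 1 ≤ s) (f : Hs s) :
    Hs.equivL2 hs f = Hs.toWeighted s f := rfl

theorem Hs.fourier_toL2 {s : ℝ} (hs : 1 ≤ s) (f : Hs s) :
    (𝓕 f.toL2 : L2) = mulOp (invWeight hs) (Hs.equivL2 hs f) := by
  refine Lp.ext ?_
  filter_upwards [coeFn_mulOp (invWeight hs) (Hs.equivL2 hs f), f.coeFn_toWeighted] with η h1 h2
  rw [h1, Hs.equivL2_apply, h2, weightedFourier, invWeight_apply, ← mul_assoc,
    ← Complex.ofReal_mul, inv_mul_cancel₀ (weight_pos _ _).ne', Complex.ofReal_one, one_mul]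

/-! ### The nonlinearity -/

theorem memLp_weight_mul_psi_mul_fourier (hν : ν < 1 / 6) (hs : 1 ≤ s) (f g : Hs s) :
    MemLp (fun η : ℝ => (weight s (2 * Real.pi * η) * psi ν (2 * Real.pi * η) : ℂ) *
        𝓕 ((f.toL2 • g.toL2 : Lp ℂ 1 (volume : Measure ℝ)) : ℝ → ℂ) η) 2 volume := by
  obtain ⟨C, -, hC⟩ := exists_bilinear_bound hν hs
  refine ⟨?_, (hC f g).trans_lt ENNReal.ofReal_lt_top⟩
  have h1 := continuous_weight s
  have h2 := continuous_psi hν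
  have h3 := continuous_fourier_coeFn (f.toL2 • g.toL2 : Lp ℂ 1 (volume : Measure ℝ))
  exact Continuous.aestronglyMeasurable (by fun_prop)

/-- The function `(1 + ξ²)^{s/2} ψ(ξ) (u²)^`. -/
def nonlinearity (hν : ν < 1 / 6) (hs : 1 ≤ s) (u : Hs s) : L2 :=
  (memLp_weight_mul_psi_mul_fourier hν hs u u).toLp _

theorem coeFn_nonlinearity (hν : ν < 1 / 6) (hs : 1 ≤ s) (u : Hs s) :
    nonlinearity hν hs u =ᵐ[volume]
      fun η : ℝ => (weight s (2 * Real.pi * η) * psi ν (2 * Real.pi * η) : ℂ) *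
        𝓕 (u.sq : ℝ → ℂ) η :=
  (memLp_weight_mul_psi_mul_fourier hν hs u u).coeFn_toLp

/-- The growth bound uses the given admissible constant, since that constant sets the lifespan. The
Lipschitz constant below may be a different one, as it does not enter the lifespan. -/
theorem norm_nonlinearity_le (hν : ν < 1 / 6) (hs : 1 ≤ s) {C : ℝ}
    (hC : IsAdmissibleConstant ν s C) (u : Hs s) : ‖nonlinearity hν hs u‖ ≤ C * ‖u‖ ^ 2 := by
  rw [nonlinearity, Lp.norm_toLp]
  exact ENNReal.toReal_le_of_le_ofReal (mul_nonneg hC.1.le (sq_nonneg _)) (hC.2 u)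

theorem exists_isAdmissibleConstant (hν : ν < 1 / 6) (hs : 1 ≤ s) :
    ∃ C, IsAdmissibleConstant ν s C := by
  obtain ⟨C, hC0, hC⟩ := exists_bilinear_bound hν hs
  refine ⟨C, hC0, fun u => (hC u u).trans_eq ?_⟩
  rw [mul_assoc, ← sq]

theorem lp_smul_comm (f g : L2) : (f • g : Lp ℂ 1 (volume : Measure ℝ)) = g • f := by
  refine Lp.ext ?_
  filter_upwards [Lp.coeFn_lpSMul (r := 1) f g, Lp.coeFn_lpSMul (r := 1) g f] with x h1 h2
  rw [h1, h2]
  exact mul_comm _ _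

theorem Hs.sq_sub_sq (u v : Hs s) :
    u.sq - v.sq = ((u - v).toL2 • (u + v).toL2 : Lp ℂ 1 (volume : Measure ℝ)) := by
  rw [map_sub, map_add, Hs.sq, Hs.sq, sub_eq_add_neg u.toL2, Lp.smul_add, Lp.add_smul, Lp.add_smul,
    Lp.neg_smul, Lp.neg_smul, lp_smul_comm v.toL2 u.toL2]
  abel

/-- Factor `u² - v² = (u - v)(u + v)` and apply the bilinear estimate to the two factors. -/
theorem exists_norm_nonlinearity_sub_le (hν : ν < 1 / 6) (hs : 1 ≤ s) :
    ∃ K, 0 ≤ K ∧ ∀ u v : Hs s,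
      ‖nonlinearity hν hs u - nonlinearity hν hs v‖ ≤ K * ‖u - v‖ * (‖u‖ + ‖v‖) := by
  obtain ⟨C, hC0, hC⟩ := exists_bilinear_bound hν hs
  refine ⟨C, hC0.le, fun u v => ?_⟩
  have e : nonlinearity hν hs u - nonlinearity hν hs v =
      (memLp_weight_mul_psi_mul_fourier hν hs (u - v) (u + v)).toLp _ := by
    rw [nonlinearity, nonlinearity, ← MemLp.toLp_sub]
    refine MemLp.toLp_congr _ _ (Eventually.of_forall fun η => ?_)
    simp only [← Hs.sq_sub_sq, fourier_coeFn_sub, mul_sub]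
    rfl
  rw [e, Lp.norm_toLp]
  refine (ENNReal.toReal_le_of_le_ofReal (by positivity) (hC _ _)).trans ?_
  exact mul_le_mul_of_nonneg_left (norm_add_le _ _) (by positivity)

/-! ### The dispersion relation and the equation in the interaction picture -/

/-- The dispersion relation `φ(ξ) = (ξ - ν ξ³) / (1 + (1/6 - ν) ξ²)`, with `ξ = 2πη`. -/
def dispersion (hν : ν < 1 / 6) : C(ℝ, ℝ) where
  toFun η := (2 * Real.pi * η - ν * (2 * Real.pi * η) ^ 3) /
    (1 + (1 / 6 - ν) * (2 * Real.pi * η) ^ 2)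
  continuous_toFun := by
    refine Continuous.div (by fun_prop) (by fun_prop) fun η => ?_
    have : 0 < 1 / 6 - ν := by linarith
    positivity

theorem dispersion_apply (hν : ν < 1 / 6) (η : ℝ) :
    dispersion hν η = (2 * Real.pi * η - ν * (2 * Real.pi * η) ^ 3) /
      (1 + (1 / 6 - ν) * (2 * Real.pi * η) ^ 2) := rfl

/-- The vector field of the equation `Z' = F(t, Z)` satisfied by
`Z(t) = e^{itφ} (1 + ξ²)^{s/2} û(t)`. -/
def interactionField (hν : ν < 1 / 6) (hs : 1 ≤ s) (t : ℝ) (z : L2) : L2 :=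
  -(Complex.I • mulOp (phase (dispersion hν) (-t))
    (nonlinearity hν hs ((Hs.equivL2 hs).symm (mulOp (phase (dispersion hν) t) z))))

/-- Strong continuity in `t` becomes joint continuity because all the operators are isometries,
hence uniformly Lipschitz. -/
theorem continuous_uncurry_mulOp_phase (φ : C(ℝ, ℝ)) :
    Continuous fun p : ℝ × L2 => mulOp (phase φ p.1) p.2 := by
  refine continuous_prod_of_continuous_lipschitzWith' _ 1
    (fun t => LipschitzWith.of_dist_le_mul fun g h => ?_)
    fun g => continuous_mulOp_phase φ g
  rw [dist_eq_norm, dist_eq_norm, ← map_sub, norm_mulOp_phase, NNReal.coe_one, one_mul]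

theorem continuous_nonlinearity (hν : ν < 1 / 6) (hs : 1 ≤ s) :
    Continuous (nonlinearity hν hs) := by
  obtain ⟨K, hK0, hK⟩ := exists_norm_nonlinearity_sub_le hν hs
  rw [continuous_iff_continuousAt]
  intro u₀
  rw [ContinuousAt, tendsto_iff_norm_sub_tendsto_zero]
  refine squeeze_zero (fun _ => norm_nonneg _) (fun u => hK u u₀) ?_
  have : Continuous fun u : Hs s => K * ‖u - u₀‖ * (‖u‖ + ‖u₀‖) := by fun_prop
  simpa using this.tendsto u₀

theorem continuous_interactionField (hν : ν < 1 / 6) (hs : 1 ≤ s) :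
    Continuous fun p : ℝ × L2 => interactionField hν hs p.1 p.2 := by
  unfold interactionField
  have h1 := (continuous_nonlinearity hν hs).comp ((Hs.equivL2 hs).symm.continuous.comp
    (continuous_uncurry_mulOp_phase (dispersion hν)))
  have h2 := (continuous_uncurry_mulOp_phase (dispersion hν)).comp
    (continuous_fst.neg.prodMk h1)
  exact (h2.const_smul Complex.I).neg

theorem exists_norm_interactionField_sub_le (hν : ν < 1 / 6) (hs : 1 ≤ s) :
    ∃ K, 0 ≤ K ∧ ∀ t x y, ‖interactionField hν hs t x - interactionField hν hs t y‖ ≤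
      K * ‖x - y‖ * (‖x‖ + ‖y‖) := by
  obtain ⟨K, hK0, hK⟩ := exists_norm_nonlinearity_sub_le hν hs
  refine ⟨K, hK0, fun t x y => ?_⟩
  have h := hK ((Hs.equivL2 hs).symm (mulOp (phase (dispersion hν) t) x))
    ((Hs.equivL2 hs).symm (mulOp (phase (dispersion hν) t) y))
  rw [← map_sub, ← map_sub, LinearIsometryEquiv.norm_map, LinearIsometryEquiv.norm_map,
    LinearIsometryEquiv.norm_map, norm_mulOp_phase, norm_mulOp_phase, norm_mulOp_phase] at h
  rw [interactionField, interactionField, ← neg_sub', norm_neg, ← smul_sub, ← map_sub, norm_smul,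
    Complex.norm_I, one_mul, norm_mulOp_phase]
  exact h

theorem norm_interactionField_le (hν : ν < 1 / 6) (hs : 1 ≤ s) {C : ℝ}
    (hC : IsAdmissibleConstant ν s C) (t : ℝ) (z : L2) :
    ‖interactionField hν hs t z‖ ≤ C * ‖z‖ ^ 2 := by
  rw [interactionField, norm_neg, norm_smul, Complex.norm_I, one_mul, norm_mulOp_phase]
  refine (norm_nonlinearity_le hν hs hC _).trans_eq ?_
  rw [LinearIsometryEquiv.norm_map, norm_mulOp_phase]

/-! ### Ordinary differential equations with a quadratically growing vector field -/

theorem lipschitzOnWith_of_quadratic {E : Type*} [NormedAddCommGroup E] {F : ℝ → E → E}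
    {K : ℝ} (hK : 0 ≤ K) {t : ℝ} (hLip : ∀ x y, ‖F t x - F t y‖ ≤ K * ‖x - y‖ * (‖x‖ + ‖y‖))
    {R : ℝ} (hR : 0 ≤ R) :
    LipschitzOnWith (Real.toNNReal (K * (2 * R))) (F t) (Metric.closedBall 0 R) := by
  refine LipschitzOnWith.of_dist_le_mul fun x hx y hy => ?_
  rw [mem_closedBall_zero_iff] at hx hy
  rw [dist_eq_norm, dist_eq_norm, Real.coe_toNNReal _ (by positivity)]
  refine (hLip x y).trans ?_
  have : K * ‖x - y‖ * (‖x‖ + ‖y‖) ≤ K * ‖x - y‖ * (2 * R) :=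
    mul_le_mul_of_nonneg_left (by linarith) (by positivity)
  linarith

section ODE

variable {E : Type*} [NormedAddCommGroup E] [NormedSpace ℝ E]

/-- `Z` solves `Z' = F(t, Z)`, `Z(0) = z₀` on `[0, T]`. -/
structure IsODESolution (F : ℝ → E → E) (T : ℝ) (z₀ : E) (Z : ℝ → E) : Prop where
  initial : Z 0 = z₀
  deriv : ∀ t ∈ Icc 0 T, HasDerivWithinAt Z (F t (Z t)) (Icc 0 T) t

variable {F : ℝ → E → E} {T : ℝ} {z₀ : E}

theorem IsODESolution.continuousOn {Z : ℝ → E} (h : IsODESolution F T z₀ Z) :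
    ContinuousOn Z (Icc 0 T) := HasDerivWithinAt.continuousOn h.deriv

theorem IsODESolution.hasDerivWithinAt_Ici {Z : ℝ → E} (h : IsODESolution F T z₀ Z) {t : ℝ}
    (ht : t ∈ Ico 0 T) : HasDerivWithinAt Z (F t (Z t)) (Ici t) t :=
  (h.deriv t (Ico_subset_Icc_self ht)).mono_of_mem_nhdsWithin (Icc_mem_nhdsGE_of_mem ht)

theorem IsODESolution.exists_norm_le {Z : ℝ → E} (h : IsODESolution F T z₀ Z) :
    ∃ R, 0 ≤ R ∧ ∀ t ∈ Icc 0 T, ‖Z t‖ ≤ R := by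
  obtain ⟨R, hR⟩ := isCompact_Icc.exists_bound_of_continuousOn h.continuousOn
  exact ⟨max R 0, le_max_right _ _, fun t ht => (hR t ht).trans (le_max_left _ _)⟩

/-- The Picard–Lindelöf theorem, with the solution confined to the ball. -/
theorem exists_isODESolution_mem_closedBall [CompleteSpace E] (hT : 0 ≤ T) {a L K : ℝ≥0}
    (hLip : ∀ t, LipschitzOnWith K (F t) (Metric.closedBall z₀ a))
    (hcont : ∀ x, Continuous fun t => F t x)
    (hbound : ∀ t, ∀ x ∈ Metric.closedBall z₀ (a : ℝ), ‖F t x‖ ≤ L) (hL : L * T ≤ a) :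
    ∃ Z, IsODESolution F T z₀ Z ∧ ∀ t ∈ Icc 0 T, Z t ∈ Metric.closedBall z₀ (a : ℝ) := by
  have hf : IsPicardLindelof F (⟨0, left_mem_Icc.2 hT⟩ : Icc 0 T) z₀ a 0 L K :=
    { lipschitzOnWith := fun t _ => hLip t
      continuousOn := fun x _ => (hcont x).continuousOn
      norm_le := fun t _ => hbound t
      mul_max_le := by simpa [hT] using hL }
  -- The fixed point is taken in the space of curves with values in the ball, which keeps the
  -- confinement along with the solution.
  obtain ⟨α, hα⟩ := ODE.FunSpace.exists_isFixedPt_next hf (Metric.mem_closedBall_self le_rfl)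
  refine ⟨α.compProj, ⟨?_, fun t ht => ?_⟩, fun t _ => α.compProj_mem_closedBall hf.mul_max_le⟩
  · have : α.compProj ((⟨0, left_mem_Icc.2 hT⟩ : Icc 0 T) : ℝ) = z₀ := by
      rw [ODE.FunSpace.compProj_val, ← hα, ODE.FunSpace.next_apply₀]
    exact this
  · apply ODE.hasDerivWithinAt_picard_Icc (left_mem_Icc.2 hT) hf.continuousOn_uncurry
      α.continuous_compProj.continuousOn
      (fun _ _ => α.compProj_mem_closedBall hf.mul_max_le) z₀ ht |>.congr_of_mem _ ht
    intro t' ht'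
    nth_rw 1 [← hα]
    rw [ODE.FunSpace.compProj_of_mem ht', ODE.FunSpace.next_apply]

/-- Local existence, with the lifespan `1 / (4 C ‖z₀‖)`. -/
theorem exists_isODESolution_norm_le [CompleteSpace E] {K C : ℝ} (hK : 0 ≤ K) (hC : 0 ≤ C)
    (hcont : ∀ x, Continuous fun t => F t x)
    (hLip : ∀ t x y, ‖F t x - F t y‖ ≤ K * ‖x - y‖ * (‖x‖ + ‖y‖))
    (hbound : ∀ t x, ‖F t x‖ ≤ C * ‖x‖ ^ 2) (hT : 0 ≤ T) (hCT : 4 * C * ‖z₀‖ * T ≤ 1) :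
    ∃ Z, IsODESolution F T z₀ Z ∧ ∀ t ∈ Icc 0 T, ‖Z t‖ ≤ 2 * ‖z₀‖ := by
  have hball : ∀ x ∈ Metric.closedBall z₀ (‖z₀‖₊ : ℝ), ‖x‖ ≤ 2 * ‖z₀‖ := fun x hx => by
    rw [Metric.mem_closedBall, dist_eq_norm, coe_nnnorm] at hx
    have := norm_add_le (x - z₀) z₀
    rw [sub_add_cancel] at this
    linarith
  -- The ball about `z₀` has radius `‖z₀‖`, so it lies in the ball of radius `2‖z₀‖` about `0`,
  -- where `‖F‖ ≤ 4C‖z₀‖²`. The Picard–Lindelöf condition is then `hCT` multiplied by `‖z₀‖`, which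
  -- also covers `z₀ = 0`.
  obtain ⟨Z, hZ, hm⟩ := exists_isODESolution_mem_closedBall (F := F) (z₀ := z₀) hT (a := ‖z₀‖₊)
    (L := Real.toNNReal (4 * C * ‖z₀‖ ^ 2)) (K := Real.toNNReal (K * (2 * (2 * ‖z₀‖))))
    (fun t => (lipschitzOnWith_of_quadratic hK (hLip t) (by positivity)).mono fun x hx =>
      mem_closedBall_zero_iff.2 (hball x hx)) hcont
    (fun t x hx => by
      rw [Real.coe_toNNReal _ (by positivity)]
      refine (hbound t x).trans ?_
      have h1 : ‖x‖ ^ 2 ≤ (2 * ‖z₀‖) ^ 2 := pow_le_pow_left₀ (norm_nonneg _) (hball x hx) 2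
      have := mul_le_mul_of_nonneg_left h1 hC
      linarith)
    (by
      rw [Real.coe_toNNReal _ (by positivity), coe_nnnorm]
      have := mul_le_mul_of_nonneg_right hCT (norm_nonneg z₀)
      linarith)
  exact ⟨Z, hZ, fun t ht => hball _ (hm t ht)⟩

/-- Gronwall's inequality on a ball containing both trajectories. -/
theorem IsODESolution.norm_sub_le {K : ℝ≥0} {R : ℝ}
    (hLip : ∀ t, LipschitzOnWith K (F t) (Metric.closedBall 0 R)) {x₀ y₀ : E} {X Y : ℝ → E}
    (hX : IsODESolution F T x₀ X) (hY : IsODESolution F T y₀ Y)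
    (hXR : ∀ t ∈ Icc 0 T, ‖X t‖ ≤ R) (hYR : ∀ t ∈ Icc 0 T, ‖Y t‖ ≤ R) :
    ∀ t ∈ Icc 0 T, ‖X t - Y t‖ ≤ ‖x₀ - y₀‖ * Real.exp (K * T) := by
  intro t ht
  have h := dist_le_of_trajectories_ODE_of_mem (s := fun _ => Metric.closedBall 0 R)
    (fun t _ => hLip t) hX.continuousOn (fun t ht => hX.hasDerivWithinAt_Ici ht)
    (fun t ht => mem_closedBall_zero_iff.2 (hXR t (Ico_subset_Icc_self ht)))
    hY.continuousOn (fun t ht => hY.hasDerivWithinAt_Ici ht)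
    (fun t ht => mem_closedBall_zero_iff.2 (hYR t (Ico_subset_Icc_self ht)))
    (δ := ‖x₀ - y₀‖) (by rw [hX.initial, hY.initial, dist_eq_norm]) t ht
  rw [dist_eq_norm, sub_zero] at h
  refine h.trans (mul_le_mul_of_nonneg_left (Real.exp_le_exp.2 ?_) (norm_nonneg _))
  exact mul_le_mul_of_nonneg_left ht.2 K.2

theorem IsODESolution.eqOn {K : ℝ} (hK : 0 ≤ K)
    (hLip : ∀ t x y, ‖F t x - F t y‖ ≤ K * ‖x - y‖ * (‖x‖ + ‖y‖)) {X Y : ℝ → E}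
    (hX : IsODESolution F T z₀ X) (hY : IsODESolution F T z₀ Y) : EqOn X Y (Icc 0 T) := by
  obtain ⟨R₁, hR₁, hX'⟩ := hX.exists_norm_le
  obtain ⟨R₂, hR₂, hY'⟩ := hY.exists_norm_le
  intro t ht
  have h := hX.norm_sub_le (fun t => lipschitzOnWith_of_quadratic hK (hLip t)
    (add_nonneg hR₁ hR₂)) hY (fun t ht => (hX' t ht).trans (by linarith))
    (fun t ht => (hY' t ht).trans (by linarith)) t ht
  rw [sub_self, norm_zero, zero_mul] at h
  exact sub_eq_zero.1 (norm_le_zero_iff.1 h)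

/-- The radial retraction onto the ball of radius `R`. -/
def radialRetraction (R : ℝ) (x : E) : E := (R / max R ‖x‖) • x

theorem radialRetraction_eq_self {R : ℝ} (hR : 0 < R) {x : E} (hx : ‖x‖ ≤ R) :
    radialRetraction R x = x := by
  rw [radialRetraction, max_eq_left hx, div_self hR.ne', one_smul]

theorem norm_radialRetraction_le {R : ℝ} (hR : 0 < R) (x : E) : ‖radialRetraction R x‖ ≤ R := by
  have hm : 0 < max R ‖x‖ := lt_max_of_lt_left hR
  rw [radialRetraction, norm_smul, Real.norm_of_nonneg (by positivity), div_mul_eq_mul_div,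
    div_le_iff₀ hm]
  exact mul_le_mul_of_nonneg_left (le_max_right _ _) hR.le

/-- Moving the point at a fixed scaling factor costs at most `‖x - y‖`, and so does changing the
scaling factor at fixed `y`. No inner product is needed. -/
theorem norm_radialRetraction_sub_le {R : ℝ} (hR : 0 < R) (x y : E) :
    ‖radialRetraction R x - radialRetraction R y‖ ≤ 2 * ‖x - y‖ := by
  have hx : 0 < max R ‖x‖ := lt_max_of_lt_left hR
  have hy : 0 < max R ‖y‖ := lt_max_of_lt_left hR
  have e : radialRetraction R x - radialRetraction R y =
      (R / max R ‖x‖) • (x - y) + (R / max R ‖x‖ - R / max R ‖y‖) • y := by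
    rw [radialRetraction, radialRetraction, smul_sub, sub_smul]
    abel
  have h1 : R / max R ‖x‖ ≤ 1 := (div_le_one hx).2 (le_max_left _ _)
  have h2 : |max R ‖y‖ - max R ‖x‖| ≤ ‖x - y‖ := by
    rw [max_comm R, max_comm R, norm_sub_rev]
    refine (abs_max_sub_max_le_abs ‖y‖ ‖x‖ R).trans ?_
    exact abs_norm_sub_norm_le _ _
  have h3 : ‖(R / max R ‖x‖ - R / max R ‖y‖) • y‖ ≤ ‖x - y‖ := by
    have e2 : R / max R ‖x‖ - R / max R ‖y‖ =
        (R / max R ‖x‖) * ((max R ‖y‖ - max R ‖x‖) / max R ‖y‖) := by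
      field_simp
    rw [e2, norm_smul, norm_mul, Real.norm_of_nonneg (by positivity : 0 ≤ R / max R ‖x‖),
      norm_div _ (max R ‖y‖), Real.norm_of_nonneg hy.le, mul_assoc]
    have h4 : ‖max R ‖y‖ - max R ‖x‖‖ / max R ‖y‖ * ‖y‖ ≤ ‖x - y‖ := by
      rw [div_mul_eq_mul_div, div_le_iff₀ hy]
      exact mul_le_mul h2 (le_max_right _ _) (norm_nonneg _) (norm_nonneg _)
    calc _ ≤ 1 * ‖x - y‖ := mul_le_mul h1 h4 (by positivity) zero_le_one
      _ = _ := one_mul _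
  rw [e]
  refine (norm_add_le _ _).trans ?_
  rw [norm_smul, Real.norm_of_nonneg (by positivity : 0 ≤ R / max R ‖x‖)]
  have := mul_le_mul_of_nonneg_right h1 (norm_nonneg (x - y))
  linarith

/-- Solutions persist under small perturbations of the data, and depend continuously on them. -/
theorem IsODESolution.exists_forall_norm_sub_lt [CompleteSpace E] {K C : ℝ} (hK : 0 ≤ K)
    (hC : 0 ≤ C) (hcont : ∀ x, Continuous fun t => F t x)
    (hLip : ∀ t x y, ‖F t x - F t y‖ ≤ K * ‖x - y‖ * (‖x‖ + ‖y‖))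
    (hbound : ∀ t x, ‖F t x‖ ≤ C * ‖x‖ ^ 2) (hT : 0 ≤ T) {X : ℝ → E}
    (hX : IsODESolution F T z₀ X) {ε : ℝ} (hε : 0 < ε) :
    ∃ δ > 0, ∀ y₀, ‖y₀ - z₀‖ < δ →
      ∃ Y, IsODESolution F T y₀ Y ∧ ∀ t ∈ Icc 0 T, ‖Y t - X t‖ < ε := by
  obtain ⟨R₀, hR₀, hX'⟩ := hX.exists_norm_le
  -- The margin `1` leaves room for nearby solutions: as long as they stay within distance `1` of
  -- `X`, truncation at radius `R` does not affect them.
  set R := R₀ + 1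
  have hR : 0 < R := by positivity
  set G : ℝ → E → E := fun t x => F t (radialRetraction R x)
  set M : ℝ≥0 := Real.toNNReal (K * (2 * R)) * 2
  have hG : ∀ t, LipschitzWith M (G t) := fun t => by
    refine LipschitzWith.of_dist_le_mul fun x y => ?_
    have h := (lipschitzOnWith_of_quadratic hK (hLip t) hR.le).dist_le_mul
      _ (mem_closedBall_zero_iff.2 (norm_radialRetraction_le hR x))
      _ (mem_closedBall_zero_iff.2 (norm_radialRetraction_le hR y))
    refine h.trans ?_
    rw [dist_eq_norm, dist_eq_norm, NNReal.coe_mul, mul_assoc]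
    exact mul_le_mul_of_nonneg_left (norm_radialRetraction_sub_le hR x y) (NNReal.coe_nonneg _)
  have hGb : ∀ t x, ‖G t x‖ ≤ C * R ^ 2 := fun t x => (hbound t _).trans
    (mul_le_mul_of_nonneg_left
      (pow_le_pow_left₀ (norm_nonneg _) (norm_radialRetraction_le hR x) 2) hC)
  have hXG : IsODESolution G T z₀ X := ⟨hX.initial, fun t ht => by
    have := hX.deriv t ht
    simp only [G]
    rwa [radialRetraction_eq_self hR ((hX' t ht).trans (by simp [R]))]⟩
  -- Gronwall for the truncated field `G` multiplies the initial gap by at most `exp (M T)`, so the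
  -- gap stays below both `ε` and `1`.
  refine ⟨min ε 1 / Real.exp (M * T), by positivity, fun y₀ hy₀ => ?_⟩
  -- Since `G` is bounded by `C R²` and globally Lipschitz, a ball of radius `C R² T` makes the
  -- whole interval `[0,T]` admissible.
  obtain ⟨Y, hY, -⟩ := exists_isODESolution_mem_closedBall (F := G) (z₀ := y₀) hT
    (a := Real.toNNReal (C * R ^ 2 * T)) (L := Real.toNNReal (C * R ^ 2)) (K := M)
    (fun t => (hG t).lipschitzOnWith) (fun x => hcont _)
    (fun t x _ => by
      rw [Real.coe_toNNReal _ (by positivity)]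
      exact hGb t x)
    (by rw [Real.coe_toNNReal _ (by positivity), Real.coe_toNNReal _ (by positivity)])
  obtain ⟨R₁, -, hY'⟩ := hY.exists_norm_le
  have hd : ∀ t ∈ Icc 0 T, ‖Y t - X t‖ < min ε 1 := fun t ht => by
    have h := hY.norm_sub_le (R := max R₀ R₁) (fun t => (hG t).lipschitzOnWith) hXG
      (fun t ht => (hY' t ht).trans (le_max_right _ _))
      (fun t ht => (hX' t ht).trans (le_max_left _ _)) t ht
    exact h.trans_lt ((lt_div_iff₀ (Real.exp_pos _)).1 hy₀)
  refine ⟨Y, ⟨hY.initial, fun t ht => ?_⟩, fun t ht => (hd t ht).trans_le (min_le_left _ _)⟩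
  have h1 : ‖Y t‖ ≤ R := by
    have h2 := norm_add_le (Y t - X t) (X t)
    rw [sub_add_cancel] at h2
    have h3 := (hd t ht).trans_le (min_le_right _ _)
    have h4 := hX' t ht
    simp only [R]
    linarith
  have := hY.deriv t ht
  simp only [G] at this
  rwa [radialRetraction_eq_self hR h1] at this

end ODE

/-! ### From weak to strong differentiability. -/

/-- A curve whose image under a separating family of functionals is differentiable, with the
derivative given by a continuous curve, is differentiable. -/
theorem hasDerivWithinAt_of_separating {E V ι : Type*} [NormedAddCommGroup E] [NormedSpace ℝ E]
    [CompleteSpace E] [NormedAddCommGroup V] [NormedSpace ℝ V] {T : ℝ} (hT : 0 ≤ T)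
    (ℓ : ι → E →L[ℝ] V) (hℓ : ∀ x, (∀ i, ℓ i x = 0) → x = 0) {y r : ℝ → E}
    (hy : ContinuousOn y (Icc 0 T)) (hr : ContinuousOn r (Icc 0 T))
    (hd : ∀ i, ∀ t ∈ Icc 0 T, HasDerivWithinAt (fun τ => ℓ i (y τ)) (ℓ i (r t)) (Icc 0 T) t) :
    ∀ t ∈ Icc 0 T, HasDerivWithinAt y (r t) (Icc 0 T) t := by
  set q : ℝ → E := IccExtend hT ((Icc 0 T).domRestrict r)
  have hq : Continuous q := (continuousOn_iff_continuous_domRestrict.1 hr).Icc_extend'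
  have hqr : ∀ t ∈ Icc 0 T, q t = r t := fun t ht => IccExtend_of_mem _ _ ht
  set R : ℝ → E := fun t => ∫ τ in (0 : ℝ)..t, q τ
  have hR : ∀ t, HasDerivAt R (q t) t := fun t => (hq.integral_hasStrictDerivAt 0 t).hasDerivAt
  -- Each functional sees `y - y 0 - ∫ r` as a curve with zero derivative that vanishes at `0`;
  -- separation makes the difference itself zero.
  have key : ∀ t ∈ Icc 0 T, y t = y 0 + R t := by
    intro t ht
    rw [← sub_eq_zero]
    refine hℓ _ fun i => ?_
    have hc : ContinuousOn (fun τ => ℓ i (y τ - (y 0 + R τ))) (Icc 0 T) :=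
      (ℓ i).continuous.comp_continuousOn (hy.sub (continuousOn_const.add
        fun τ _ => (hR τ).continuousAt.continuousWithinAt))
    have h := constant_of_has_deriv_right_zero hc (fun τ hτ => ?_) t ht
    · rw [h]
      simp [R]
    · have h1 := (hd i τ (Ico_subset_Icc_self hτ)).mono_of_mem_nhdsWithin
        (Icc_mem_nhdsGE_of_mem hτ)
      have h2 : HasDerivWithinAt (fun τ => ℓ i (y 0 + R τ)) (ℓ i (q τ)) (Ici τ) τ :=
        ((ℓ i).hasFDerivAt.comp_hasDerivAt τ ((hR τ).const_add (y 0))).hasDerivWithinAt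
      have h3 := h1.sub h2
      rw [hqr τ (Ico_subset_Icc_self hτ), sub_self] at h3
      refine h3.congr_of_eventuallyEq (Eventually.of_forall fun σ => ?_) ?_ <;>
      simp
  intro t ht
  rw [← hqr t ht]
  exact ((hR t).const_add (y 0)).hasDerivWithinAt.congr key (key t ht)

/-! ### Pairings with Schwartz functions on the Fourier side -/

theorem integrable_mul_schwartz (f : L2) (g : 𝓢(ℝ, ℂ)) : Integrable fun η => f η * g η :=
  (Lp.memLp f).integrable_mul (g.memLp 2)

theorem integrable_fourier_mul_schwartz (h : Lp ℂ 1 (volume : Measure ℝ)) (g : 𝓢(ℝ, ℂ)) :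
    Integrable fun η => 𝓕 (h : ℝ → ℂ) η * g η := by
  refine g.integrable.bdd_mul (c := ‖h‖) (continuous_fourier_coeFn h).aestronglyMeasurable ?_
  refine Eventually.of_forall fun η => ?_
  rw [L1.norm_eq_integral_norm]
  exact VectorFourier.norm_fourierIntegral_le_integral_norm _ _ _ _ _

theorem toTemperedDistribution_apply_eq_integral_fourier (f : L2) (w : 𝓢(ℝ, ℂ)) :
    Lp.toTemperedDistribution f w = ∫ η, (𝓕 f : L2) η * 𝓕⁻ w η := by
  have h1 : Lp.toTemperedDistribution f w = 𝓕 (Lp.toTemperedDistribution f) (𝓕⁻ w) := by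
    rw [TemperedDistribution.fourier_apply, FourierTransform.fourier_fourierInv_eq]
  rw [h1, Lp.fourier_toTemperedDistribution_eq, Lp.toTemperedDistribution_apply]
  refine integral_congr_ae (Eventually.of_forall fun η => ?_)
  exact mul_comm _ _

/-- Fubini, in the form `∫ 𝓕h · g = ∫ h · 𝓕g` with `g = 𝓕⁻ w`. This version serves `u²`, which is
represented as an `L¹` function. -/
theorem toTemperedDistribution_L1_apply_eq_integral_fourier (h : Lp ℂ 1 (volume : Measure ℝ))
    (w : 𝓢(ℝ, ℂ)) :
    Lp.toTemperedDistribution h w = ∫ η, 𝓕 (h : ℝ → ℂ) η * 𝓕⁻ w η := by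
  have h1 := VectorFourier.integral_fourierIntegral_smul_eq_flip (μ := volume) (ν := volume)
    (L := innerₗ ℝ) Real.continuous_fourierChar (by exact continuous_inner)
    (L1.integrable_coeFn h) (𝓕⁻ w).integrable
  rw [flip_innerₗ] at h1
  have h2 : VectorFourier.fourierIntegral Real.fourierChar volume (innerₗ ℝ)
      ((𝓕⁻ w : 𝓢(ℝ, ℂ)) : ℝ → ℂ) = w := by
    change 𝓕 ((𝓕⁻ w : 𝓢(ℝ, ℂ)) : ℝ → ℂ) = w
    rw [← SchwartzMap.fourier_coe, FourierTransform.fourier_fourierInv_eq]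
  rw [h2] at h1
  rw [Lp.toTemperedDistribution_apply]
  refine Eq.trans (integral_congr_ae (Eventually.of_forall fun x => ?_)) h1.symm
  exact mul_comm _ _

theorem fourierInv_derivCLM_apply (w : 𝓢(ℝ, ℂ)) (η : ℝ) :
    𝓕⁻ (SchwartzMap.derivCLM ℂ ℂ w) η = -(Complex.I * (2 * Real.pi * η : ℝ)) * 𝓕⁻ w η := by
  rw [SchwartzMap.fourierInv_coe, SchwartzMap.fourierInv_coe, Real.fourierInv_eq_fourier_neg,
    Real.fourierInv_eq_fourier_neg]
  have h : (SchwartzMap.derivCLM ℂ ℂ w : ℝ → ℂ) = deriv w := by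
    ext x
    exact SchwartzMap.derivCLM_apply ℂ w x
  have hi : Integrable (deriv w) := by
    rw [← h]
    exact (SchwartzMap.derivCLM ℂ ℂ w).integrable
  rw [h, Real.fourier_deriv w.integrable w.differentiable hi]
  simp only [smul_eq_mul]
  push_cast
  ring

/-! ### Regularized symbols -/

/-- The multiplier `1 / (1 + (1/6 - ν) ξ²)`. -/
def regularizer (hν : ν < 1 / 6) : ℝ →ᵇ ℂ :=
  BoundedContinuousFunction.ofNormedAddCommGroup
    (fun η => (((1 + (1 / 6 - ν) * (2 * Real.pi * η) ^ 2)⁻¹ : ℝ) : ℂ))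
    (Complex.continuous_ofReal.comp (Continuous.inv₀ (by fun_prop) fun η => by
      have : 0 < 1 / 6 - ν := by linarith
      positivity)) 1
    (fun η => by
      have : 0 < 1 / 6 - ν := by linarith
      rw [Complex.norm_real, Real.norm_of_nonneg (by positivity)]
      exact inv_le_one_of_one_le₀ (by nlinarith [mul_nonneg this.le (sq_nonneg (2 * Real.pi * η))]))

theorem regularizer_apply (hν : ν < 1 / 6) (η : ℝ) :
    regularizer hν η = (((1 + (1 / 6 - ν) * (2 * Real.pi * η) ^ 2)⁻¹ : ℝ) : ℂ) := rfl

theorem one_add_mul_sq_pos (hν : ν < 1 / 6) (x : ℝ) : 0 < 1 + (1 / 6 - ν) * x ^ 2 := by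
  have : 0 < 1 / 6 - ν := by linarith
  positivity

theorem regularizer_ne_zero (hν : ν < 1 / 6) (η : ℝ) : regularizer hν η ≠ 0 := by
  rw [regularizer_apply]
  exact Complex.ofReal_ne_zero.2 (inv_ne_zero (one_add_mul_sq_pos hν _).ne')

theorem norm_regularizer_apply (hν : ν < 1 / 6) (η : ℝ) :
    ‖regularizer hν η‖ = (1 + (1 / 6 - ν) * (2 * Real.pi * η) ^ 2)⁻¹ := by
  rw [regularizer_apply, Complex.norm_real,
    Real.norm_of_nonneg (inv_nonneg.2 (one_add_mul_sq_pos hν _).le)]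

/-- The linear part costs at most one derivative. Hence `φ (1 + ξ²)^{-s/2}` is bounded for `s ≥ 1`,
and so is `φ² / (1 + (1/6 - ν)ξ²)`. -/
theorem exists_abs_dispersion_le (hν : ν < 1 / 6) :
    ∃ c, 0 ≤ c ∧ ∀ η, |dispersion hν η| ≤ c * |2 * Real.pi * η| := by
  have ha : 0 < 1 / 6 - ν := by linarith
  refine ⟨1 + |ν| / (1 / 6 - ν), by positivity, fun η => ?_⟩
  set x := 2 * Real.pi * η
  have hD := one_add_mul_sq_pos hν x
  rw [dispersion_apply, abs_div, abs_of_pos hD, div_le_iff₀ hD,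
    show x - ν * x ^ 3 = x * (1 - ν * x ^ 2) by ring, abs_mul]
  have h1 : |1 - ν * x ^ 2| ≤ 1 + |ν| * x ^ 2 := by
    refine (abs_sub _ _).trans ?_
    rw [abs_one, abs_mul, abs_of_nonneg (sq_nonneg x)]
  have h2 : 1 + |ν| * x ^ 2 ≤ (1 + |ν| / (1 / 6 - ν)) * (1 + (1 / 6 - ν) * x ^ 2) := by
    have e : (1 + |ν| / (1 / 6 - ν)) * (1 + (1 / 6 - ν) * x ^ 2) =
        1 + |ν| * x ^ 2 + (|ν| / (1 / 6 - ν) + (1 / 6 - ν) * x ^ 2) := by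
      generalize 1 / 6 - ν = a at ha ⊢
      field_simp
      ring
    rw [e]
    have : 0 ≤ |ν| / (1 / 6 - ν) + (1 / 6 - ν) * x ^ 2 := by positivity
    linarith
  exact (mul_le_mul_of_nonneg_left (h1.trans h2) (abs_nonneg x)).trans_eq (by ring)

theorem exists_dispersion_sq_mul_le (hν : ν < 1 / 6) :
    ∃ B, ∀ η, dispersion hν η ^ 2 * ‖regularizer hν η‖ ≤ B := by
  obtain ⟨c, hc, h⟩ := exists_abs_dispersion_le hν
  have ha : 0 < 1 / 6 - ν := by linarith
  refine ⟨c ^ 2 / (1 / 6 - ν), fun η => ?_⟩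
  have hD := one_add_mul_sq_pos hν (2 * Real.pi * η)
  have h1 : dispersion hν η ^ 2 ≤ c ^ 2 * (2 * Real.pi * η) ^ 2 := by
    rw [← sq_abs, ← sq_abs (2 * Real.pi * η), ← mul_pow]
    exact pow_le_pow_left₀ (abs_nonneg _) (h η) 2
  rw [norm_regularizer_apply, ← div_eq_mul_inv, div_le_div_iff₀ hD ha]
  nlinarith [sq_nonneg c, mul_le_mul_of_nonneg_right h1 ha.le]

/-- The multiplier `φ(ξ) / (1 + (1/6 - ν) ξ²)`. -/
def dispersionRegularizer (hν : ν < 1 / 6) : ℝ →ᵇ ℂ :=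
  BoundedContinuousFunction.ofNormedAddCommGroup
    (fun η => (dispersion hν η : ℂ) * regularizer hν η) (by fun_prop)
    (1 + (exists_dispersion_sq_mul_le hν).choose)
    (fun η => by
      have h := (exists_dispersion_sq_mul_le hν).choose_spec η
      have h1 : ‖regularizer hν η‖ ≤ 1 := by
        rw [norm_regularizer_apply]
        refine inv_le_one_of_one_le₀ ?_
        have : 0 < 1 / 6 - ν := by linarith
        nlinarith [mul_nonneg this.le (sq_nonneg (2 * Real.pi * η))]
      rw [norm_mul, Complex.norm_real, Real.norm_eq_abs]
      have h2 : |dispersion hν η| ≤ 1 + dispersion hν η ^ 2 := by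
        nlinarith [sq_nonneg (|dispersion hν η| - 1), sq_abs (dispersion hν η)]
      nlinarith [norm_nonneg (regularizer hν η)])

theorem dispersionRegularizer_apply (hν : ν < 1 / 6) (η : ℝ) :
    dispersionRegularizer hν η = dispersion hν η * regularizer hν η := rfl

/-- The multiplier `φ(ξ) (1 + ξ²)^{-s/2}`. -/
def dispersionInvWeight (hν : ν < 1 / 6) (hs : 1 ≤ s) : ℝ →ᵇ ℂ :=
  BoundedContinuousFunction.ofNormedAddCommGroup
    (fun η => (dispersion hν η : ℂ) * invWeight hs η) (by fun_prop)
    (exists_abs_dispersion_le hν).choose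
    (fun η => by
      obtain ⟨hc, h⟩ := (exists_abs_dispersion_le hν).choose_spec
      have hw := weight_pos s (2 * Real.pi * η)
      rw [norm_mul, invWeight_apply, Complex.norm_real, Complex.norm_real, Real.norm_eq_abs,
        Real.norm_of_nonneg (inv_nonneg.2 hw.le), ← div_eq_mul_inv, div_le_iff₀ hw]
      refine (h η).trans (mul_le_mul_of_nonneg_left ?_ hc)
      refine abs_le_of_sq_le_sq ?_ hw.le
      have := one_add_sq_le_weight_sq hs (2 * Real.pi * η)
      linarith)

theorem dispersionInvWeight_apply (hν : ν < 1 / 6) (hs : 1 ≤ s) (η : ℝ) :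
    dispersionInvWeight hν hs η = dispersion hν η * invWeight hs η := rfl

theorem hasDerivAt_regularizer_mul_phase (hν : ν < 1 / 6) (t : ℝ) :
    HasDerivAt (fun τ => regularizer hν * phase (dispersion hν) τ)
      (-(Complex.I • (dispersionRegularizer hν * phase (dispersion hν) t))) t :=
  hasDerivAt_mul_phase (dispersionRegularizer_apply hν)
    (exists_dispersion_sq_mul_le hν).choose_spec t

/-! ### The weak equation on the Fourier side -/

/-- The operator `1 - (1/6 - ν) ∂ₓ²` on Schwartz functions. -/
def helmholtz (ν : ℝ) (w : 𝓢(ℝ, ℂ)) : 𝓢(ℝ, ℂ) :=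
  w - ((1 / 6 - ν : ℝ) : ℂ) • SchwartzMap.derivCLM ℂ ℂ (SchwartzMap.derivCLM ℂ ℂ w)

theorem fourierInv_helmholtz_apply (ν : ℝ) (w : 𝓢(ℝ, ℂ)) (η : ℝ) :
    𝓕⁻ (helmholtz ν w) η = ((1 + (1 / 6 - ν) * (2 * Real.pi * η) ^ 2 : ℝ) : ℂ) * 𝓕⁻ w η := by
  have h : 𝓕⁻ (helmholtz ν w) = 𝓕⁻ w - ((1 / 6 - ν : ℝ) : ℂ) •
      𝓕⁻ (SchwartzMap.derivCLM ℂ ℂ (SchwartzMap.derivCLM ℂ ℂ w)) := by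
    rw [helmholtz, sub_eq_add_neg, FourierTransform.fourierInv_add, FourierTransform.fourierInv_neg,
      FourierTransform.fourierInv_smul, ← sub_eq_add_neg]
  rw [h, sub_apply, smul_apply, fourierInv_derivCLM_apply,
    fourierInv_derivCLM_apply, smul_eq_mul]
  push_cast
  linear_combination (-(1 / 6 - (ν : ℂ)) * (2 * Real.pi * η) ^ 2 * 𝓕⁻ w η) * Complex.I_sq

/-- The bilinear pairing `(y, h) ↦ ∫ y h` on `L²`. -/
def pairL2 (h : L2) : L2 →L[ℂ] ℂ :=
  ((ContinuousLinearMap.mul ℂ ℂ).lpPairing volume 2 2).flip h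

theorem pairL2_apply (h y : L2) : pairL2 h y = ∫ η, y η * h η :=
  (ContinuousLinearMap.flip_apply _ _ _).trans
    ((ContinuousLinearMap.mul ℂ ℂ).lpPairing_eq_integral y h)

/-- The function `(1 + (1/6 - ν) ξ²) (1 + ξ²)^{-s/2} 𝓕⁻ w`. -/
def testFunction (ν : ℝ) (hs : 1 ≤ s) (w : 𝓢(ℝ, ℂ)) : L2 :=
  mulOp (invWeight hs) ((𝓕⁻ (helmholtz ν w)).toLp 2)

theorem coeFn_testFunction (ν : ℝ) (hs : 1 ≤ s) (w : 𝓢(ℝ, ℂ)) :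
    testFunction ν hs w =ᵐ[volume] fun η => invWeight hs η *
      (((1 + (1 / 6 - ν) * (2 * Real.pi * η) ^ 2 : ℝ) : ℂ) * 𝓕⁻ w η) := by
  filter_upwards [coeFn_mulOp (invWeight hs) ((𝓕⁻ (helmholtz ν w)).toLp 2),
    (𝓕⁻ (helmholtz ν w)).coeFn_toLp 2 volume] with η h1 h2
  rw [testFunction, h1, h2, fourierInv_helmholtz_apply]

theorem mul_regularizer (hν : ν < 1 / 6) (η : ℝ) :
    ((1 + (1 / 6 - ν) * (2 * Real.pi * η) ^ 2 : ℝ) : ℂ) * regularizer hν η = 1 := by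
  rw [regularizer_apply, ← Complex.ofReal_mul, mul_inv_cancel₀ (one_add_mul_sq_pos hν _).ne',
    Complex.ofReal_one]

/-- The factor `1 + (1/6 - ν)ξ²` in the test function undoes the regularizer, so regularized curves
in `L²` can be compared with the unregularized distributions. -/
theorem pairL2_testFunction_regularizer (hν : ν < 1 / 6) (hs : 1 ≤ s) (w : 𝓢(ℝ, ℂ)) (u : Hs s) :
    pairL2 (testFunction ν hs w) (mulOp (regularizer hν) (Hs.equivL2 hs u)) =
      u.toDistribution w := by
  rw [pairL2_apply, Hs.toDistribution, toTemperedDistribution_apply_eq_integral_fourier,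
    Hs.fourier_toL2 hs]
  refine integral_congr_ae ?_
  filter_upwards [coeFn_testFunction ν hs w, coeFn_mulOp (regularizer hν) (Hs.equivL2 hs u),
    coeFn_mulOp (invWeight hs) (Hs.equivL2 hs u)] with η h1 h2 h3
  rw [h1, h2, h3]
  linear_combination (invWeight hs η * Hs.equivL2 hs u η * 𝓕⁻ w η) * mul_regularizer hν η

/-- Taking `w = 𝓕 G` with `G` smooth and compactly supported, the hypothesis says that `y θ`
integrates to zero against every such `G`, where `θ` has no zeros. The factor `1 + (1/6 - ν)ξ²` is
squared because it enters once through `testFunction` and once through `helmholtz`. -/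
theorem eq_zero_of_pairL2_testFunction (hν : ν < 1 / 6) (hs : 1 ≤ s) {y : L2}
    (h : ∀ w, pairL2 (testFunction ν hs (helmholtz ν w)) y = 0) : y = 0 := by
  set θ : ℝ → ℂ := fun η => invWeight hs η *
    ((1 + (1 / 6 - ν) * (2 * Real.pi * η) ^ 2 : ℝ) : ℂ) ^ 2
  have hθ : Continuous θ := by fun_prop
  have hloc : LocallyIntegrable (fun η => y η * θ η) := by
    have hy : LocallyIntegrable (fun η => y η) :=
      (Lp.memLp y).locallyIntegrable (by norm_num)
    have := (hy.locallyIntegrableOn univ).mul_continuousOn hθ.continuousOn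
      isOpen_univ.isLocallyClosed
    exact locallyIntegrableOn_univ.1 this
  have hz := ae_eq_zero_of_integral_contDiff_smul_eq_zero hloc fun g hg hgc => by
    have hg' := Complex.ofRealCLM.contDiff.comp hg
    have hgc' : HasCompactSupport (Complex.ofRealCLM ∘ g) := hgc.comp_left Complex.ofReal_zero
    set G : 𝓢(ℝ, ℂ) := hgc'.toSchwartzMap hg'
    have hG := h (𝓕 G)
    rw [pairL2_apply] at hG
    rw [← hG]
    refine integral_congr_ae ?_
    filter_upwards [coeFn_testFunction ν hs (helmholtz ν (𝓕 G))] with η h1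
    rw [h1, fourierInv_helmholtz_apply, FourierTransform.fourierInv_fourier_eq]
    have : G η = g η := rfl
    rw [this, Complex.real_smul]
    simp only [θ]
    ring
  refine Lp.ext ?_
  filter_upwards [hz, Lp.coeFn_zero ℂ 2 (volume : Measure ℝ)] with η h1 h2
  rw [h2]
  refine (mul_eq_zero.1 h1).resolve_right (mul_ne_zero ?_ (pow_ne_zero 2 ?_))
  · rw [invWeight_apply]
    exact Complex.ofReal_ne_zero.2 (inv_ne_zero (weight_pos _ _).ne')
  · exact Complex.ofReal_ne_zero.2 (one_add_mul_sq_pos hν _).ne'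

/-- The Fourier transform `-i (φ û + ψ (u²)^)` of the time derivative of a solution. -/
def fourierVelocity (hν : ν < 1 / 6) (hs : 1 ≤ s) (u : Hs s) : L2 :=
  -(Complex.I • (mulOp (dispersionInvWeight hν hs) (Hs.equivL2 hs u) +
    mulOp (invWeight hs) (nonlinearity hν hs u)))

/-- The regularized, weighted Fourier transform of the time derivative of a solution. -/
def regularizedVelocity (hν : ν < 1 / 6) (hs : 1 ≤ s) (u : Hs s) : L2 :=
  -(Complex.I • (mulOp (dispersionRegularizer hν) (Hs.equivL2 hs u) +
    mulOp (regularizer hν) (nonlinearity hν hs u)))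

theorem coeFn_neg_I_smul_add (f g : L2) :
    (-(Complex.I • (f + g)) : L2) =ᵐ[volume] fun η => -(Complex.I * (f η + g η)) := by
  filter_upwards [Lp.coeFn_neg (Complex.I • (f + g)), Lp.coeFn_smul Complex.I (f + g),
    Lp.coeFn_add f g] with η h1 h2 h3
  rw [h1, Pi.neg_apply, h2, Pi.smul_apply, h3, Pi.add_apply, smul_eq_mul]

/-- The tempered distribution `u_t` associated with `u`. -/
def velocity (hν : ν < 1 / 6) (hs : 1 ≤ s) (u : Hs s) : 𝓢'(ℝ, ℂ) :=
  Lp.toTemperedDistribution (𝓕⁻ (fourierVelocity hν hs u) : L2)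

theorem velocity_apply (hν : ν < 1 / 6) (hs : 1 ≤ s) (u : Hs s) (w : 𝓢(ℝ, ℂ)) :
    velocity hν hs u w = ∫ η, fourierVelocity hν hs u η * 𝓕⁻ w η := by
  rw [velocity, toTemperedDistribution_apply_eq_integral_fourier,
    FourierTransform.fourier_fourierInv_eq]

theorem pairL2_testFunction_regularizedVelocity (hν : ν < 1 / 6) (hs : 1 ≤ s) (w : 𝓢(ℝ, ℂ))
    (u : Hs s) :
    pairL2 (testFunction ν hs w) (regularizedVelocity hν hs u) = velocity hν hs u w := by
  rw [pairL2_apply, velocity_apply]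
  refine integral_congr_ae ?_
  filter_upwards [coeFn_testFunction ν hs w,
    coeFn_neg_I_smul_add (mulOp (dispersionRegularizer hν) (Hs.equivL2 hs u))
      (mulOp (regularizer hν) (nonlinearity hν hs u)),
    coeFn_neg_I_smul_add (mulOp (dispersionInvWeight hν hs) (Hs.equivL2 hs u))
      (mulOp (invWeight hs) (nonlinearity hν hs u)),
    coeFn_mulOp (dispersionRegularizer hν) (Hs.equivL2 hs u),
    coeFn_mulOp (regularizer hν) (nonlinearity hν hs u),
    coeFn_mulOp (dispersionInvWeight hν hs) (Hs.equivL2 hs u),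
    coeFn_mulOp (invWeight hs) (nonlinearity hν hs u)] with η h1 h2 h3 h4 h5 h6 h7
  rw [regularizedVelocity, fourierVelocity, h1, h2, h3, h4, h5, h6, h7,
    dispersionRegularizer_apply, dispersionInvWeight_apply]
  linear_combination (-(Complex.I * invWeight hs η * 𝓕⁻ w η *
    (dispersion hν η * Hs.equivL2 hs u η + nonlinearity hν hs u η))) * mul_regularizer hν η

theorem mul_dispersion (hν : ν < 1 / 6) (η : ℝ) :
    (1 + (1 / 6 - ν) * (2 * Real.pi * η) ^ 2) * dispersion hν η =
      2 * Real.pi * η - ν * (2 * Real.pi * η) ^ 3 := by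
  rw [dispersion_apply, mul_div_cancel₀ _ (one_add_mul_sq_pos hν _).ne']

theorem mul_psi (hν : ν < 1 / 6) (ξ : ℝ) :
    (1 + (1 / 6 - ν) * ξ ^ 2) * psi ν ξ = 3 / 4 * ξ := by
  have := (one_add_mul_sq_pos hν ξ).ne'
  rw [psi, add_comm ((1 / 6 - ν) * ξ ^ 2), mul_div_assoc', mul_comm (4 : ℝ),
    mul_div_mul_left _ _ this]
  ring

/-- The equation, tested against a Schwartz function, determines `(1 - (1/6 - ν) ∂ₓ²) u_t`. -/
theorem velocity_helmholtz (hν : ν < 1 / 6) (hs : 1 ≤ s) (u : Hs s) (w : 𝓢(ℝ, ℂ)) :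
    velocity hν hs u (helmholtz ν w) = -(Dx u.toDistribution w
        + (3 / 4) * Dx (Lp.toTemperedDistribution u.sq) w
        + ν * Dx (Dx (Dx u.toDistribution)) w) := by
  set D := SchwartzMap.derivCLM ℂ ℂ
  have hD : ∀ (w : 𝓢(ℝ, ℂ)) (η : ℝ),
      𝓕⁻ (-D w) η = Complex.I * (2 * Real.pi * η : ℝ) * 𝓕⁻ w η := fun w η => by
    rw [FourierTransform.fourierInv_neg, neg_apply, fourierInv_derivCLM_apply]
    ring
  have e1 : Dx u.toDistribution w = ∫ η, (𝓕 u.toL2 : L2) η * 𝓕⁻ (-D w) η :=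
    toTemperedDistribution_apply_eq_integral_fourier _ _
  have e2 : Dx (Lp.toTemperedDistribution u.sq) w = ∫ η, 𝓕 (u.sq : ℝ → ℂ) η * 𝓕⁻ (-D w) η :=
    toTemperedDistribution_L1_apply_eq_integral_fourier _ _
  have e3 : Dx (Dx (Dx u.toDistribution)) w =
      ∫ η, (𝓕 u.toL2 : L2) η * 𝓕⁻ (-D (-D (-D w))) η :=
    toTemperedDistribution_apply_eq_integral_fourier _ _
  rw [velocity_apply, e1, e2, e3, ← integral_const_mul, ← integral_const_mul, ← integral_add,
    ← integral_add, ← integral_neg]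
  rotate_left
  · exact (integrable_mul_schwartz _ _).add ((integrable_fourier_mul_schwartz _ _).const_mul _)
  · exact (integrable_mul_schwartz _ _).const_mul _
  · exact integrable_mul_schwartz _ _
  · exact (integrable_fourier_mul_schwartz _ _).const_mul _
  refine integral_congr_ae ?_
  have hU := Hs.fourier_toL2 hs u
  filter_upwards [coeFn_neg_I_smul_add (mulOp (dispersionInvWeight hν hs) (Hs.equivL2 hs u))
      (mulOp (invWeight hs) (nonlinearity hν hs u)),
    coeFn_mulOp (dispersionInvWeight hν hs) (Hs.equivL2 hs u),
    coeFn_mulOp (invWeight hs) (nonlinearity hν hs u), coeFn_nonlinearity hν hs u,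
    coeFn_mulOp (invWeight hs) (Hs.equivL2 hs u)] with η h1 h2 h3 h4 h5
  rw [fourierVelocity, h1, h2, h3, h4, hU, h5, dispersionInvWeight_apply, hD, hD, hD, hD,
    fourierInv_helmholtz_apply]
  -- With `A = 1 + (1/6 - ν)ξ²`, the identities `A φ = ξ - νξ³` and `A ψ = (3/4) ξ` turn `-i A (φ û
  -- + ψ (u²)^)` into the symbols of the spatial terms.
  have c1 : ((1 + (1 / 6 - ν) * (2 * Real.pi * η) ^ 2 : ℝ) : ℂ) * dispersion hν η =
      ((2 * Real.pi * η : ℝ) : ℂ) - ν * ((2 * Real.pi * η : ℝ) : ℂ) ^ 3 := by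
    rw [← Complex.ofReal_mul, mul_dispersion]
    push_cast
    rfl
  have c2 : ((1 + (1 / 6 - ν) * (2 * Real.pi * η) ^ 2 : ℝ) : ℂ) * psi ν (2 * Real.pi * η) =
      3 / 4 * ((2 * Real.pi * η : ℝ) : ℂ) := by
    rw [← Complex.ofReal_mul, mul_psi hν]
    push_cast
    rfl
  have c3 : invWeight hs η * (weight s (2 * Real.pi * η) : ℂ) = 1 := by
    rw [invWeight_apply, ← Complex.ofReal_mul, inv_mul_cancel₀ (weight_pos _ _).ne',
      Complex.ofReal_one]
  generalize ((1 + (1 / 6 - ν) * (2 * Real.pi * η) ^ 2 : ℝ) : ℂ) = A at *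
  generalize ((2 * Real.pi * η : ℝ) : ℂ) = x at *
  generalize (dispersion hν η : ℂ) = φ at *
  generalize 𝓕 (u.sq : ℝ → ℂ) η = S
  generalize 𝓕⁻ w η = g
  generalize (Hs.equivL2 hs u : ℝ → ℂ) η = z
  linear_combination (-(Complex.I * invWeight hs η * z * g)) * c1
    - (Complex.I * S * g) * c2
    - (Complex.I * A * psi ν (2 * Real.pi * η) * S * g) * c3
    + (ν * x ^ 3 * invWeight hs η * z * g * Complex.I) * Complex.I_sq

/-! ### Equivalence of the weak equation with the differential equation in `L²` -/

/-- The interaction picture `Z(t) = e^{itφ} (1 + ξ²)^{s/2} û(t)` of a curve in `H^s`. -/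
def interaction (hν : ν < 1 / 6) (hs : 1 ≤ s) (u : ℝ → Hs s) (t : ℝ) : L2 :=
  mulOp (phase (dispersion hν) (-t)) (Hs.equivL2 hs (u t))

/-- The curve in `H^s` with a given interaction picture. -/
def ofInteraction (hν : ν < 1 / 6) (hs : 1 ≤ s) (Z : ℝ → L2) (t : ℝ) : Hs s :=
  (Hs.equivL2 hs).symm (mulOp (phase (dispersion hν) t) (Z t))

theorem equivL2_ofInteraction (hν : ν < 1 / 6) (hs : 1 ≤ s) (Z : ℝ → L2) (t : ℝ) :
    Hs.equivL2 hs (ofInteraction hν hs Z t) = mulOp (phase (dispersion hν) t) (Z t) :=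
  LinearIsometryEquiv.apply_symm_apply _ _

theorem interaction_ofInteraction (hν : ν < 1 / 6) (hs : 1 ≤ s) (Z : ℝ → L2) :
    interaction hν hs (ofInteraction hν hs Z) = Z := by
  ext1 t
  rw [interaction, equivL2_ofInteraction, mulOp_neg_phase]

theorem norm_interaction_sub (hν : ν < 1 / 6) (hs : 1 ≤ s) (u v : ℝ → Hs s) (t : ℝ) :
    ‖interaction hν hs u t - interaction hν hs v t‖ = ‖u t - v t‖ := by
  rw [interaction, interaction, ← map_sub, norm_mulOp_phase, ← map_sub,
    LinearIsometryEquiv.norm_map]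

theorem norm_ofInteraction (hν : ν < 1 / 6) (hs : 1 ≤ s) (Z : ℝ → L2) (t : ℝ) :
    ‖ofInteraction hν hs Z t‖ = ‖Z t‖ := by
  rw [ofInteraction, LinearIsometryEquiv.norm_map, norm_mulOp_phase]

theorem interactionField_interaction (hν : ν < 1 / 6) (hs : 1 ≤ s) (u : ℝ → Hs s) (t : ℝ) :
    interactionField hν hs t (interaction hν hs u t) =
      -(Complex.I • mulOp (phase (dispersion hν) (-t)) (nonlinearity hν hs (u t))) := by
  rw [interactionField, interaction, mulOp_phase_neg, LinearIsometryEquiv.symm_apply_apply]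

theorem continuous_regularizedVelocity (hν : ν < 1 / 6) (hs : 1 ≤ s) :
    Continuous (regularizedVelocity hν hs : Hs s → L2) := by
  unfold regularizedVelocity
  have h1 := (mulOp (dispersionRegularizer hν)).continuous.comp (Hs.equivL2 hs).continuous
  have h2 := (mulOp (regularizer hν)).continuous.comp (continuous_nonlinearity hν hs)
  exact ((h1.add h2).const_smul Complex.I).neg

theorem continuousOn_mulOp_phase {φ : C(ℝ, ℝ)} {c : ℝ → ℝ} (hc : Continuous c) {Z : ℝ → L2}
    {S : Set ℝ} (hZ : ContinuousOn Z S) :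
    ContinuousOn (fun t => mulOp (phase φ (c t)) (Z t)) S := by
  have h := (continuous_uncurry_mulOp_phase φ).comp_continuousOn (hc.continuousOn.prodMk hZ)
  simpa only [Function.comp_def] using h

/-- The derivative of a distribution-valued solution. -/
theorem IsSolution.hasDerivWithinAt_helmholtz (hν : ν < 1 / 6) (hs : 1 ≤ s) {T : ℝ} {u₀ : Hs s}
    {u : ℝ → Hs s} (h : IsSolution ν T u₀ u) (w : 𝓢(ℝ, ℂ)) {t : ℝ} (ht : t ∈ Icc 0 T) :
    HasDerivWithinAt (fun τ => (u τ).toDistribution (helmholtz ν w))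
      (velocity hν hs (u t) (helmholtz ν w)) (Icc 0 T) t := by
  obtain ⟨u_t, hd, he⟩ := h.equation
  have h1 : velocity hν hs (u t) (helmholtz ν w) = u_t t (helmholtz ν w) := by
    have h2 : Dx (Dx (u_t t)) w =
        u_t t (SchwartzMap.derivCLM ℂ ℂ (SchwartzMap.derivCLM ℂ ℂ w)) := by
      simp only [TemperedDistribution.derivCLM_apply_apply, map_neg, neg_neg]
    have h3 := he t ht w
    rw [h2] at h3
    rw [velocity_helmholtz, helmholtz, map_sub, map_smul, smul_eq_mul]
    push_cast
    linear_combination -h3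
  rw [h1]
  exact hd t ht _

/-- The regularizer turns the velocity into a continuous curve in `L²`, because `φκ` is bounded.
Testing only against `helmholtz ν w` suffices, since these pairings already separate points. -/
theorem IsSolution.hasDerivWithinAt_regularized (hν : ν < 1 / 6) (hs : 1 ≤ s) {T : ℝ}
    (hT : 0 ≤ T) {u₀ : Hs s} {u : ℝ → Hs s} (h : IsSolution ν T u₀ u) :
    ∀ t ∈ Icc 0 T, HasDerivWithinAt (fun τ => mulOp (regularizer hν) (Hs.equivL2 hs (u τ)))
      (regularizedVelocity hν hs (u t)) (Icc 0 T) t := by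
  refine hasDerivWithinAt_of_separating hT
    (fun w : 𝓢(ℝ, ℂ) => (pairL2 (testFunction ν hs (helmholtz ν w))).restrictScalars ℝ)
    (fun y hy => eq_zero_of_pairL2_testFunction hν hs hy)
    (((mulOp (regularizer hν)).continuous.comp (Hs.equivL2 hs).continuous).comp_continuousOn
      h.continuousOn)
    ((continuous_regularizedVelocity hν hs).comp_continuousOn h.continuousOn)
    fun w t ht => ?_
  simp only [ContinuousLinearMap.coe_restrictScalars', pairL2_testFunction_regularizer hν hs,
    pairL2_testFunction_regularizedVelocity]
  exact h.hasDerivWithinAt_helmholtz hν hs w ht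

/-- The bilinear map `(m, g) ↦ m g`, over the reals. -/
def mulOpReal : (ℝ →ᵇ ℂ) →L[ℝ] L2 →L[ℝ] L2 :=
  (ContinuousLinearMap.restrictScalarsL ℂ L2 L2 ℝ ℝ).comp (mulOp.restrictScalars ℝ)

theorem hasDerivWithinAt_mulOp {m : ℝ → ℝ →ᵇ ℂ} {g : ℝ → L2} {m' : ℝ →ᵇ ℂ} {g' : L2} {S : Set ℝ}
    {t : ℝ} (hm : HasDerivWithinAt m m' S t) (hg : HasDerivWithinAt g g' S t) :
    HasDerivWithinAt (fun τ => mulOp (m τ) (g τ)) (mulOp m' (g t) + mulOp (m t) g') S t := by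
  have h1 := (mulOpReal.hasFDerivAt (x := m t)).comp_hasDerivWithinAt t hm
  exact h1.clm_apply hg

/-- One factor `κ` makes the phase differentiable in the supremum norm, the other makes `W û`
differentiable in `L²`. The product rule gives the derivative of `κ² Z`, and the injective
multiplier `κ²` is then removed by the separation criterion, used with a single functional. -/
theorem IsSolution.isODESolution (hν : ν < 1 / 6) (hs : 1 ≤ s) {T : ℝ}
    (hT : 0 ≤ T) {u₀ : Hs s} {u : ℝ → Hs s} (h : IsSolution ν T u₀ u) :
    IsODESolution (interactionField hν hs) T (Hs.equivL2 hs u₀) (interaction hν hs u) := by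
  have hcont : ContinuousOn (interaction hν hs u) (Icc 0 T) :=
    continuousOn_mulOp_phase continuous_neg
      ((Hs.equivL2 hs).continuous.comp_continuousOn h.continuousOn)
  have hF : ContinuousOn (fun t => interactionField hν hs t (interaction hν hs u t)) (Icc 0 T) := by
    have h := (continuous_interactionField hν hs).comp_continuousOn (continuousOn_id.prodMk hcont)
    simpa only [Function.comp_def, id] using h
  refine ⟨?_, ?_⟩
  · rw [interaction, neg_zero, phase_zero, mulOp_one, h.initial]
  set κ := regularizer hν
  refine hasDerivWithinAt_of_separating hT
    (fun _ : Unit => (mulOp (κ * κ)).restrictScalars ℝ)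
    (fun y hy => mulOp_eq_zero (fun η => mul_ne_zero (regularizer_ne_zero hν η)
      (regularizer_ne_zero hν η)) (hy ())) hcont
    hF fun _ t ht => ?_
  have h1 : HasDerivAt (fun τ => κ * phase (dispersion hν) (-τ))
      (Complex.I • (dispersionRegularizer hν * phase (dispersion hν) (-t))) t := by
    have := (hasDerivAt_regularizer_mul_phase hν (-t)).scomp t (hasDerivAt_neg t)
    rw [neg_smul, one_smul, neg_neg] at this
    exact this
  have h2 := hasDerivWithinAt_mulOp h1.hasDerivWithinAt
    (h.hasDerivWithinAt_regularized hν hs hT t ht)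
  refine (h2.congr_deriv ?_).congr_of_mem (fun τ _ => ?_) ht
  -- The term `iφ` from the phase cancels the dispersive term of the velocity, leaving the
  -- nonlinearity.
  · change _ = mulOp (κ * κ) (interactionField hν hs t (interaction hν hs u t))
    rw [interactionField_interaction, regularizedVelocity]
    simp only [map_neg, map_smul, smul_apply, smul_add, map_add, ← mulOp_mul]
    rw [show dispersionRegularizer hν * phase (dispersion hν) (-t) * regularizer hν =
        κ * phase (dispersion hν) (-t) * dispersionRegularizer hν by ring,
      show κ * phase (dispersion hν) (-t) * regularizer hν =
        κ * κ * phase (dispersion hν) (-t) by ring]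
    abel
  · change mulOp (κ * κ) (interaction hν hs u τ) = _
    rw [interaction, ← mulOp_mul, ← mulOp_mul]
    congr 2
    ring

/-- Here `Z` is differentiable in `L²` from the start, so a single `κ`, for the phase, is enough;
pairing with `testFunction` removes it again. -/
theorem IsODESolution.isSolution (hν : ν < 1 / 6) (hs : 1 ≤ s) {T : ℝ} {u₀ : Hs s} {Z : ℝ → L2}
    (h : IsODESolution (interactionField hν hs) T (Hs.equivL2 hs u₀) Z) :
    IsSolution ν T u₀ (ofInteraction hν hs Z) := by
  set u := ofInteraction hν hs Z
  set κ := regularizer hν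
  have hreg : ∀ t ∈ Icc 0 T, HasDerivWithinAt (fun τ => mulOp κ (Hs.equivL2 hs (u τ)))
      (regularizedVelocity hν hs (u t)) (Icc 0 T) t := fun t ht => by
    have h2 := hasDerivWithinAt_mulOp (hasDerivAt_regularizer_mul_phase hν t).hasDerivWithinAt
      (h.deriv t ht)
    refine (h2.congr_deriv ?_).congr_of_mem (fun τ _ => ?_) ht
    · have e : interactionField hν hs t (Z t) =
          -(Complex.I • mulOp (phase (dispersion hν) (-t)) (nonlinearity hν hs (u t))) := rfl
      rw [e, regularizedVelocity, equivL2_ofInteraction]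
      simp only [map_neg, map_smul, smul_apply, neg_apply,
        smul_add, ← mulOp_mul]
      rw [show regularizer hν * phase (dispersion hν) t * phase (dispersion hν) (-t) =
        regularizer hν by rw [mul_assoc, ← phase_add, add_neg_cancel, phase_zero, mul_one]]
      abel
    · rw [equivL2_ofInteraction, ← mulOp_mul]
  refine ⟨?_, ?_, fun t => velocity hν hs (u t), fun t ht w => ?_, fun t _ w => ?_⟩
  · exact (Hs.equivL2 hs).symm.continuous.comp_continuousOn
      (continuousOn_mulOp_phase continuous_id h.continuousOn)
  · change (Hs.equivL2 hs).symm (mulOp (phase (dispersion hν) 0) (Z 0)) = u₀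
    rw [h.initial, phase_zero, mulOp_one, LinearIsometryEquiv.symm_apply_apply]
  · have := ((pairL2 (testFunction ν hs w)).restrictScalars ℝ).hasFDerivAt.comp_hasDerivWithinAt t
      (hreg t ht)
    simp only [ContinuousLinearMap.coe_restrictScalars', Function.comp_def, κ,
      pairL2_testFunction_regularizer, pairL2_testFunction_regularizedVelocity] at this
    exact this
  · have h2 : Dx (Dx (velocity hν hs (u t))) w = velocity hν hs (u t)
        (SchwartzMap.derivCLM ℂ ℂ (SchwartzMap.derivCLM ℂ ℂ w)) := by
      simp only [TemperedDistribution.derivCLM_apply_apply, map_neg, neg_neg]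
    have h3 := velocity_helmholtz hν hs (u t) w
    rw [helmholtz, map_sub, map_smul, smul_eq_mul] at h3
    push_cast at h3
    rw [h2]
    linear_combination h3

/-! ### Complex conjugation -/

/-- Pointwise complex conjugation on `L²`. -/
def conjL2 : L2 →L[ℝ] L2 := (Complex.conjCLE : ℂ →L[ℝ] ℂ).compLpL 2 volume

theorem coeFn_conjL2 (f : L2) : conjL2 f =ᵐ[volume] fun x => conj (f x) :=
  (Complex.conjCLE : ℂ →L[ℝ] ℂ).coeFn_compLpL f

/-- The reflection `z ↦ (η ↦ conj (z (-η)))`, which is complex conjugation on the Fourier side. -/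
def conjReflect : L2 →L[ℝ] L2 :=
  conjL2.comp (Lp.compMeasurePreservingₗᵢ ℝ (Neg.neg : ℝ → ℝ)
    (Measure.measurePreserving_neg volume)).toContinuousLinearMap

theorem coeFn_conjReflect (z : L2) : conjReflect z =ᵐ[volume] fun η => conj (z (-η)) := by
  set N := Lp.compMeasurePreservingₗᵢ ℝ (p := 2) (E := ℂ) (Neg.neg : ℝ → ℝ)
    (Measure.measurePreserving_neg volume)
  have hN : N z =ᵐ[volume] fun η => z (-η) := Lp.coeFn_compMeasurePreserving z _
  have h : conjReflect z = conjL2 (N z) := rfl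
  filter_upwards [coeFn_conjL2 (N z), hN] with η h1 h2
  rw [h, h1, h2]

theorem ae_neg {p : ℝ → Prop} (h : ∀ᵐ η : ℝ, p η) : ∀ᵐ η : ℝ, p (-η) :=
  (Measure.measurePreserving_neg (volume : Measure ℝ)).quasiMeasurePreserving.ae h

theorem conjReflect_smul (c : ℂ) (z : L2) : conjReflect (c • z) = conj c • conjReflect z := by
  refine Lp.ext ?_
  filter_upwards [coeFn_conjReflect (c • z), Lp.coeFn_smul (conj c) (conjReflect z),
    coeFn_conjReflect z, ae_neg (Lp.coeFn_smul c z)] with η h1 h2 h3 h4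
  rw [h1, h2, Pi.smul_apply, h3, h4, Pi.smul_apply, smul_eq_mul, smul_eq_mul, map_mul]

theorem conjReflect_mulOp {m : ℝ →ᵇ ℂ} (hm : ∀ η, conj (m (-η)) = m η) (z : L2) :
    conjReflect (mulOp m z) = mulOp m (conjReflect z) := by
  refine Lp.ext ?_
  filter_upwards [coeFn_conjReflect (mulOp m z), coeFn_mulOp m (conjReflect z),
    coeFn_conjReflect z, ae_neg (coeFn_mulOp m z)] with η h1 h2 h3 h4
  rw [h1, h2, h3, h4, map_mul, hm]

theorem conj_fourier_neg (f : ℝ → ℂ) (η : ℝ) : conj (𝓕 f (-η)) = 𝓕 (fun x => conj (f x)) η := by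
  rw [Real.fourier_real_eq_integral_exp_smul, Real.fourier_real_eq_integral_exp_smul,
    ← integral_conj]
  refine integral_congr_ae (Eventually.of_forall fun x => ?_)
  simp only [smul_eq_mul, map_mul, ← Complex.exp_conj, Complex.conj_I, Complex.conj_ofReal]
  congr 2
  push_cast
  ring

theorem fourier_conjL2 (f : L2) : (𝓕 (conjL2 f) : L2) = conjReflect (𝓕 f) := by
  have hF : Continuous fun f : L2 => (𝓕 f : L2) := FourierTransform.continuous_fourier
  refine (SchwartzMap.denseRange_toLpCLM (F := ℂ) (E := ℝ) (p := 2) (μ := volume)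
    (ENNReal.ofNat_ne_top)).induction_on
    (p := fun f : L2 => (𝓕 (conjL2 f) : L2) = conjReflect (𝓕 f)) f (isClosed_eq (hF.comp conjL2.continuous) (conjReflect.continuous.comp hF)) fun g => ?_
  simp only [SchwartzMap.toLpCLM_apply]
  set g' : 𝓢(ℝ, ℂ) := SchwartzMap.postcompCLM (𝕜 := ℝ) (Complex.conjCLE : ℂ →L[ℝ] ℂ) g
  have hg : ∀ x, g' x = conj (g x) := fun x => rfl
  have h1 : conjL2 (g.toLp 2 : L2) = g'.toLp 2 := by
    refine Lp.ext ?_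
    filter_upwards [coeFn_conjL2 (g.toLp 2 : L2), g.coeFn_toLp 2 volume,
      g'.coeFn_toLp 2 volume] with x h1 h2 h3
    rw [h1, h2, h3, hg]
  rw [h1, SchwartzMap.toLp_fourier_eq, SchwartzMap.toLp_fourier_eq]
  refine Lp.ext ?_
  filter_upwards [coeFn_conjReflect ((𝓕 g).toLp 2), ae_neg ((𝓕 g).coeFn_toLp 2 volume),
    (𝓕 g').coeFn_toLp 2 volume] with η h1 h2 h3
  rw [h1, h2, h3, SchwartzMap.fourier_coe, SchwartzMap.fourier_coe, conj_fourier_neg]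
  rfl

/-- Reflection changes the sign of the odd real function `φ`, and conjugation changes it back. -/
theorem conj_phase_neg (hν : ν < 1 / 6) (t η : ℝ) :
    conj (phase (dispersion hν) t (-η)) = phase (dispersion hν) t η := by
  have h : dispersion hν (-η) = -dispersion hν η := by
    rw [dispersion_apply, dispersion_apply, ← neg_div]
    congr 1 <;> ring
  rw [phase_apply, phase_apply, h, ← Complex.exp_conj, map_mul, Complex.conj_I,
    Complex.conj_ofReal]
  congr 1
  push_cast
  ring

theorem weight_neg (s ξ : ℝ) : weight s (-ξ) = weight s ξ := by
  rw [weight, weight, neg_sq]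

theorem psi_neg (ν ξ : ℝ) : psi ν (-ξ) = -psi ν ξ := by
  rw [psi, psi, neg_sq, mul_neg, neg_div]

theorem conj_invWeight_neg (hs : 1 ≤ s) (η : ℝ) : conj (invWeight hs (-η)) = invWeight hs η := by
  rw [invWeight_apply, invWeight_apply, Complex.conj_ofReal, mul_neg, weight_neg]

theorem invWeight_ne_zero (hs : 1 ≤ s) (η : ℝ) : invWeight hs η ≠ 0 := by
  rw [invWeight_apply]
  exact Complex.ofReal_ne_zero.2 (inv_ne_zero (weight_pos _ _).ne')

theorem fourier_conjL2_toL2 (hs : 1 ≤ s) (u : Hs s) :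
    (𝓕 (conjL2 u.toL2) : L2) = mulOp (invWeight hs) (conjReflect (Hs.equivL2 hs u)) := by
  rw [fourier_conjL2, Hs.fourier_toL2 hs, conjReflect_mulOp (conj_invWeight_neg hs)]

theorem Hs.toL2_eq_conjL2 (hs : 1 ≤ s) {u v : Hs s}
    (h : Hs.equivL2 hs v = conjReflect (Hs.equivL2 hs u)) : v.toL2 = conjL2 u.toL2 := by
  have h1 : (𝓕 v.toL2 : L2) = 𝓕 (conjL2 u.toL2) := by
    rw [fourier_conjL2_toL2 hs, Hs.fourier_toL2 hs, h]
  rw [← FourierTransform.fourierInv_fourier_eq (F := L2) v.toL2, h1,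
    FourierTransform.fourierInv_fourier_eq]

theorem Hs.isReal_iff (hs : 1 ≤ s) (u : Hs s) :
    u.IsReal ↔ conjReflect (Hs.equivL2 hs u) = Hs.equivL2 hs u := by
  have h1 : u.IsReal ↔ conjL2 u.toL2 = u.toL2 := by
    rw [Lp.ext_iff]
    refine ⟨fun h => ?_, fun h => ?_⟩
    · filter_upwards [h, coeFn_conjL2 u.toL2] with x hx h2
      rw [h2]
      exact Complex.conj_eq_iff_im.2 hx
    · filter_upwards [h, coeFn_conjL2 u.toL2] with x hx h2
      rw [h2] at hx
      exact Complex.conj_eq_iff_im.1 hx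
  rw [h1]
  refine ⟨fun h => ?_, fun h => (Hs.toL2_eq_conjL2 hs h.symm).symm⟩
  have h2 := fourier_conjL2_toL2 hs u
  rw [h, Hs.fourier_toL2 hs, ← sub_eq_zero, ← map_sub] at h2
  exact (sub_eq_zero.1 (mulOp_eq_zero (invWeight_ne_zero hs) h2)).symm

/-- The hypothesis says that `v` is the conjugate of `u`. The minus sign comes from `ψ` being real
and odd; in `interactionField` it is absorbed by the conjugate of the factor `i`. -/
theorem conjReflect_nonlinearity (hν : ν < 1 / 6) (hs : 1 ≤ s) {u v : Hs s}
    (h : Hs.equivL2 hs v = conjReflect (Hs.equivL2 hs u)) :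
    conjReflect (nonlinearity hν hs u) = -nonlinearity hν hs v := by
  have hv := Hs.toL2_eq_conjL2 hs h
  have hsq : (v.sq : ℝ → ℂ) =ᵐ[volume] fun x => conj ((u.sq : ℝ → ℂ) x) := by
    rw [Hs.sq, Hs.sq, hv]
    filter_upwards [Lp.coeFn_lpSMul (r := 1) (conjL2 u.toL2) (conjL2 u.toL2),
      Lp.coeFn_lpSMul (r := 1) u.toL2 u.toL2, coeFn_conjL2 u.toL2] with x h1 h2 h3
    rw [h1, h2, Pi.smul_apply', Pi.smul_apply', h3, smul_eq_mul, smul_eq_mul, map_mul]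
  have hF : ∀ η, 𝓕 (v.sq : ℝ → ℂ) η = conj (𝓕 (u.sq : ℝ → ℂ) (-η)) := fun η => by
    rw [conj_fourier_neg, Real.fourier_real_eq, Real.fourier_real_eq]
    refine integral_congr_ae ?_
    filter_upwards [hsq] with x hx
    rw [hx]
  refine Lp.ext ?_
  filter_upwards [coeFn_conjReflect (nonlinearity hν hs u), Lp.coeFn_neg (nonlinearity hν hs v),
    coeFn_nonlinearity hν hs v, ae_neg (coeFn_nonlinearity hν hs u)] with η h1 h2 h3 h4
  rw [h1, h2, Pi.neg_apply, h3, h4, hF, map_mul, map_mul, Complex.conj_ofReal,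
    Complex.conj_ofReal, mul_neg, weight_neg, psi_neg]
  push_cast
  ring

theorem conjReflect_interactionField (hν : ν < 1 / 6) (hs : 1 ≤ s) (t : ℝ) (z : L2) :
    conjReflect (interactionField hν hs t z) = interactionField hν hs t (conjReflect z) := by
  rw [interactionField, interactionField, map_neg, conjReflect_smul,
    conjReflect_mulOp (conj_phase_neg hν (-t)), ← conjReflect_mulOp (conj_phase_neg hν t),
    conjReflect_nonlinearity hν hs (v := (Hs.equivL2 hs).symm
      (conjReflect (mulOp (phase (dispersion hν) t) z)))]
  · rw [Complex.conj_I, map_neg, neg_smul, smul_neg, neg_neg]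
  · rw [LinearIsometryEquiv.apply_symm_apply, LinearIsometryEquiv.apply_symm_apply]

theorem IsODESolution.conjReflect {hν : ν < 1 / 6} {hs : 1 ≤ s} {T : ℝ} {z₀ : L2} {Z : ℝ → L2}
    (h : IsODESolution (interactionField hν hs) T z₀ Z) :
    IsODESolution (interactionField hν hs) T (conjReflect z₀) fun t => KdVBBM.conjReflect (Z t) :=
  ⟨congrArg _ h.initial, fun t ht => by
    rw [← conjReflect_interactionField]
    exact KdVBBM.conjReflect.hasFDerivAt.comp_hasDerivWithinAt t (h.deriv t ht)⟩

/-! ### Well-posedness -/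

theorem exists_isSolution (hν : ν < 1 / 6) (hs : 1 ≤ s) {C : ℝ} (hC : IsAdmissibleConstant ν s C)
    (u₀ : Hs s) {T : ℝ} (hT : 0 ≤ T) (hCT : 4 * C * ‖u₀‖ * T ≤ 1) :
    ∃ u : ℝ → Hs s, IsSolution ν T u₀ u ∧ ∀ t ∈ Icc 0 T, ‖u t‖ ≤ 2 * ‖u₀‖ := by
  obtain ⟨K, hK, hLip⟩ := exists_norm_interactionField_sub_le hν hs
  have hn : ‖Hs.equivL2 hs u₀‖ = ‖u₀‖ := LinearIsometryEquiv.norm_map _ _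
  obtain ⟨Z, hZ, hb⟩ := exists_isODESolution_norm_le (z₀ := Hs.equivL2 hs u₀) hK hC.1.le
    (fun x => (continuous_interactionField hν hs).comp
      (by fun_prop : Continuous fun t : ℝ => (t, x)))
    hLip (norm_interactionField_le hν hs hC) hT (by rwa [hn])
  refine ⟨ofInteraction hν hs Z, hZ.isSolution, fun t ht => ?_⟩
  rw [norm_ofInteraction, ← hn]
  exact hb t ht

theorem le_maximalTime (hν : ν < 1 / 6) (hs : 1 ≤ s) {C : ℝ} (hC : IsAdmissibleConstant ν s C)
    (u₀ : Hs s) : (ENNReal.ofReal (4 * C * ‖u₀‖))⁻¹ ≤ maximalTime ν u₀ := by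
  have key : ∀ T : ℝ, 0 < T → 4 * C * ‖u₀‖ * T ≤ 1 → ENNReal.ofReal T ≤ maximalTime ν u₀ :=
    fun T hT hCT => by
      obtain ⟨u, hu, -⟩ := exists_isSolution hν hs hC u₀ hT.le hCT
      exact le_iSup₂_of_le T ⟨hT, u, hu⟩ le_rfl
  -- For zero data the left side is `∞` and every `T > 0` is allowed; `r + 1` below keeps `T`
  -- positive when `r = 0`.
  rcases (norm_nonneg u₀).eq_or_lt with h | h
  · have htop : maximalTime ν u₀ = ∞ := by
      refine ENNReal.eq_top_of_forall_nnreal_le fun r => ?_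
      refine le_trans ?_ (key (r + 1) (by positivity) (by rw [← h]; simp))
      rw [← ENNReal.ofReal_coe_nnreal]
      exact ENNReal.ofReal_le_ofReal (by linarith)
    rw [htop]
    exact le_top
  · have hpos : 0 < 4 * C * ‖u₀‖ := mul_pos (mul_pos (by norm_num) hC.1) h
    rw [← ENNReal.ofReal_inv_of_pos hpos]
    exact key _ (inv_pos.2 hpos) (mul_inv_cancel₀ hpos.ne').le

theorem IsSolution.eqOn (hν : ν < 1 / 6) (hs : 1 ≤ s) {T : ℝ} (hT : 0 ≤ T) {u₀ : Hs s}
    {u v : ℝ → Hs s} (hu : IsSolution ν T u₀ u) (hv : IsSolution ν T u₀ v) :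
    EqOn u v (Icc 0 T) := by
  obtain ⟨K, hK, hLip⟩ := exists_norm_interactionField_sub_le hν hs
  intro t ht
  have h := (hu.isODESolution hν hs hT).eqOn hK hLip (hv.isODESolution hν hs hT) ht
  rw [← sub_eq_zero, ← norm_eq_zero, norm_interaction_sub] at h
  exact sub_eq_zero.1 (norm_eq_zero.1 h)

theorem IsSolution.exists_forall_norm_sub_lt (hν : ν < 1 / 6) (hs : 1 ≤ s) {T : ℝ} (hT : 0 ≤ T)
    {u₀ : Hs s} {u : ℝ → Hs s} (hu : IsSolution ν T u₀ u) {ε : ℝ} (hε : 0 < ε) :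
    ∃ δ > 0, ∀ v₀ : Hs s, ‖v₀ - u₀‖ < δ →
      ∃ v : ℝ → Hs s, IsSolution ν T v₀ v ∧ ∀ t ∈ Icc 0 T, ‖v t - u t‖ < ε := by
  obtain ⟨K, hK, hLip⟩ := exists_norm_interactionField_sub_le hν hs
  obtain ⟨C, hC⟩ := exists_isAdmissibleConstant hν hs
  obtain ⟨δ, hδ, h⟩ := (hu.isODESolution hν hs hT).exists_forall_norm_sub_lt hK hC.1.le
    (fun x => (continuous_interactionField hν hs).comp
      (by fun_prop : Continuous fun t : ℝ => (t, x)))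
    hLip (norm_interactionField_le hν hs hC) hT hε
  refine ⟨δ, hδ, fun v₀ hv₀ => ?_⟩
  obtain ⟨Y, hY, hYX⟩ := h (Hs.equivL2 hs v₀) (by
    rwa [← map_sub, LinearIsometryEquiv.norm_map])
  refine ⟨ofInteraction hν hs Y, hY.isSolution, fun t ht => ?_⟩
  rw [← norm_interaction_sub hν hs, interaction_ofInteraction]
  exact hYX t ht

/-- The conjugate of the solution has the same initial value and solves the same `L²` equation, so
uniqueness identifies the two. -/
theorem IsSolution.isReal (hν : ν < 1 / 6) (hs : 1 ≤ s) {T : ℝ} (hT : 0 ≤ T) {u₀ : Hs s}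
    {u : ℝ → Hs s} (hu : IsSolution ν T u₀ u) (hu₀ : u₀.IsReal) :
    ∀ t ∈ Icc 0 T, (u t).IsReal := by
  obtain ⟨K, hK, hLip⟩ := exists_norm_interactionField_sub_le hν hs
  have hZ := hu.isODESolution hν hs hT
  have hZ' := hZ.conjReflect
  rw [(Hs.isReal_iff hs u₀).1 hu₀] at hZ'
  intro t ht
  have h : conjReflect (interaction hν hs u t) = interaction hν hs u t :=
    hZ'.eqOn hK hLip hZ ht
  rw [Hs.isReal_iff hs]
  have e : Hs.equivL2 hs (u t) = mulOp (phase (dispersion hν) t) (interaction hν hs u t) := by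
    rw [interaction, mulOp_phase_neg]
  rw [e, conjReflect_mulOp (conj_phase_neg hν t), h]

end KdVBBM

end

theorem theorem1 (ν s : ℝ) (hν : ν < 1 / 6) (hs : 1 ≤ s) :
    -- the constants `C_s`, which depend on `ν` and `s` only, exist
    (∃ C : ℝ, KdVBBM.IsAdmissibleConstant ν s C) ∧
    -- local existence, with the time and the bound in terms of the norm of the data
    (∀ C : ℝ, KdVBBM.IsAdmissibleConstant ν s C → ∀ u₀ : KdVBBM.Hs s,
      (∀ T : ℝ, 0 < T → 4 * C * ‖u₀‖ * T ≤ 1 →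
        ∃ u : ℝ → KdVBBM.Hs s, KdVBBM.IsSolution ν T u₀ u ∧
          ∀ t ∈ Set.Icc 0 T, ‖u t‖ ≤ 2 * ‖u₀‖) ∧
      (ENNReal.ofReal (4 * C * ‖u₀‖))⁻¹ ≤ KdVBBM.maximalTime ν u₀) ∧
    -- uniqueness in `C([0,T]; H^s)`
    (∀ T : ℝ, 0 < T → ∀ (u₀ : KdVBBM.Hs s) (u v : ℝ → KdVBBM.Hs s),
      KdVBBM.IsSolution ν T u₀ u → KdVBBM.IsSolution ν T u₀ v → Set.EqOn u v (Set.Icc 0 T)) ∧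
    -- continuous dependence on the data, from `H^s` to `C([0,T]; H^s)`
    (∀ T : ℝ, 0 < T → ∀ (u₀ : KdVBBM.Hs s) (u : ℝ → KdVBBM.Hs s), KdVBBM.IsSolution ν T u₀ u →
      ∀ ε > 0, ∃ δ > 0, ∀ v₀ : KdVBBM.Hs s, ‖v₀ - u₀‖ < δ →
        ∃ v : ℝ → KdVBBM.Hs s, KdVBBM.IsSolution ν T v₀ v ∧
          ∀ t ∈ Set.Icc 0 T, ‖v t - u t‖ < ε) ∧
    -- real data have real solutions
    (∀ T : ℝ, 0 < T → ∀ (u₀ : KdVBBM.Hs s) (u : ℝ → KdVBBM.Hs s), KdVBBM.IsSolution ν T u₀ u →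
      u₀.IsReal → ∀ t ∈ Set.Icc 0 T, (u t).IsReal) := by
  refine ⟨KdVBBM.exists_isAdmissibleConstant hν hs, fun C hC u₀ =>
    ⟨fun T hT hCT => KdVBBM.exists_isSolution hν hs hC u₀ hT.le hCT,
      KdVBBM.le_maximalTime hν hs hC u₀⟩,
    fun T hT u₀ u v hu hv => hu.eqOn hν hs hT.le hv,
    fun T hT u₀ u hu ε hε => hu.exists_forall_norm_sub_lt hν hs hT.le hε,
    fun T hT u₀ u hu hu₀ => hu.isReal hν hs hT.le hu₀⟩
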